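/- Let $T$ be a complete first-order theory and let $\mathfrak{C}$ be a monster model of $T$, that is, a $\kappa$-saturated and strongly $\kappa$-homogeneous model, where $\kappa$ is a strong limit cardinal larger than $|T|$ (the number of formulas of the language). Let $A\subseteq\mathfrak{C}$ be a set with $|A|<\kappa$, and let $a$, $b$ be (possibly infinite) tuples of elements of $\mathfrak{C}$ of length less than $\kappa$. A family $(\varphi(x,c_i):i<\omega)$ is $k$-inconsistent if the conjunction of any $k$ of its members with pairwise distinct indices is inconsistent. A formula $\varphi(x,c)$ divides over $A$ if there are $k<\omega$ and realizations $(c_i)_{i<\omega}$ of $\mathrm{tp}(c/A)$ such that $(\varphi(x,c_i):i<\omega)$ is $k$-inconsistent; a partial type forks over $A$ if it implies a finite disjunction of formulas each of which divides over $A$. We write $a\perp_A b$ ($a$ is independent from $b$ over $A$) if $\mathrm{tp}(a/Ab)$ does not fork over $A$. The theory $T$ is simple if no formula has the tree property, i.e. there are no formula $\varphi(x,y)$ with $x$, $y$ finite, $k<\omega$ and parameters $(a_s : s\in\omega^{<\omega})$ such that $(\varphi(x,a_{s^\frown i}):i<\omega)$ is $k$-inconsistent for every $s\in\omega^{<\omega}$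 and $\{\varphi(x,a_{f\upharpoonright n}):1\le n<\omega\}$ is consistent for every $f:\omega\to\omega$. For a partial type $p(x)$ and an ordinal $\alpha$ we write $\alpha_+\le DD(p)$ if there are formulas $(\varphi_j(x,y_j))_{j<\alpha}$ without parameters (each $y_j$ a finite tuple), natural numbers $(k_j)_{j<\alpha}$ and parameters $(a_{s,i}:s\in\omega^{<\alpha},\,i<\omega)$ such that (a) for each $s\in\omega^{<\alpha}$, $(\varphi_{|s|}(x,a_{s,i}):i<\omega)$ is $k_{|s|}$-inconsistent; (b) for each $f:\alpha\to\omega$, $p(x)\cup\{\varphi_j(x,a_{f\upharpoonright j,f(j)}):j<\alpha\}$ is consistent. We write $\alpha_+\le DD(a/A)$ for $\alpha_+\le DD(\mathrm{tp}(a/A))$. Suppose that $T$ is simple and $a\perp_A b$. If $\alpha_+\le DD(a/A)$ and $\beta_+\le DD(b/Aa)$, then $(\alpha\oplus\beta)_+\le DD(ab/A)$, where $\oplus$ is the natural (Hessenberg) sum of ordinals. -/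

import Mathlib

open FirstOrder

universe u v w x t

namespace DividingDepth

/-- The natural (Hessenberg) sum of ordinals: `α ⊕ β` is the least ordinal that is greater than
all `α' ⊕ β` with `α' < α` and all `α ⊕ β'` with `β' < β`. -/
noncomputable def natSum (α β : Ordinal.{t}) : Ordinal.{t} :=
  max (⨆ γ : Set.Iio α, Order.succ (natSum γ.1 β)) (⨆ γ : Set.Iio β, Order.succ (natSum α γ.1))
termination_by (α, β)
decreasing_by
  · exact Prod.Lex.left _ _ γ.2
  · exact Prod.Lex.right _ γ.2

section Types

variable (L : FirstOrder.Language.{u, v}) (M : Type w) [L.Structure M]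

/-- First-order formulas in the variables `ι` with parameters from `M`. Only finitely many of the
variables and of the parameters occur in any given formula. -/
abbrev ParamFormula (ι : Type x) := L.Formula (ι ⊕ M)

variable {L M} {ι : Type x}

/-- `M ⊨ φ(e)`. -/
def Sat (φ : ParamFormula L M ι) (e : ι → M) : Prop :=
  φ.Realize (Sum.elim e id)

/-- The formula `φ(x, c)` with parameters that is obtained by substituting the tuple `c` for `y`
in `φ(x, y)`. -/
def inst {n : ℕ} (φ : L.Formula (ι ⊕ Fin n)) (c : Fin n → M) : ParamFormula L M ι :=
  φ.relabel (Sum.map id c)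

/-- All the parameters of the formula lie in `A`. -/
def IsOver (A : Set M) (φ : ParamFormula L M ι) : Prop :=
  ∃ ψ : L.Formula (ι ⊕ A), φ = ψ.relabel (Sum.map id (fun c : A => (c : M)))

/-- A set of formulas with parameters is consistent (with the elementary diagram of `M`) if it is
finitely satisfiable in `M`. -/
def Consistent (p : Set (ParamFormula L M ι)) : Prop :=
  ∀ q : Set (ParamFormula L M ι), q ⊆ p → q.Finite → ∃ e : ι → M, ∀ φ ∈ q, Sat φ e

variable (L) in
/-- The complete type `tp(a/A)`. -/
def tp (A : Set M) (a : ι → M) : Set (ParamFormula L M ι) :=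
  {φ | IsOver A φ ∧ Sat φ a}

/-- The family `(φ(x, c i) : i < ω)` is `k`-inconsistent: the conjunction of any `k` of its members,
with pairwise different indices, is inconsistent. -/
def KInconsistent (k : ℕ) {n : ℕ} (φ : L.Formula (ι ⊕ Fin n)) (c : ℕ → Fin n → M) : Prop :=
  ∀ s : Finset ℕ, s.card = k → ¬ ∃ e : ι → M, ∀ i ∈ s, Sat (inst φ (c i)) e

/-- The formula `φ(x, c)` divides over `A`. -/
def Divides (A : Set M) {n : ℕ} (φ : L.Formula (ι ⊕ Fin n)) (c : Fin n → M) : Prop :=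
  ∃ (k : ℕ) (d : ℕ → Fin n → M), (∀ i, tp L A (d i) = tp L A c) ∧ KInconsistent k φ d

/-- The partial type `p` forks over `A`: it implies a finite disjunction of formulas (with arbitrary
parameters in `M`), each of which divides over `A`. -/
def Forks (A : Set M) (p : Set (ParamFormula L M ι)) : Prop :=
  ∃ (m : ℕ) (n : Fin m → ℕ) (φ : ∀ j, L.Formula (ι ⊕ Fin (n j))) (c : ∀ j, Fin (n j) → M),
    (∀ j, Divides A (φ j) (c j)) ∧
    ∃ q : Set (ParamFormula L M ι), q ⊆ p ∧ q.Finite ∧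
      ∀ e : ι → M, (∀ θ ∈ q, Sat θ e) → ∃ j, Sat (inst (φ j) (c j)) e

variable (L) in
/-- `a` is independent from `b` over `A`: `tp(a/Ab)` does not fork over `A`. -/
def Indep {ι' : Type x} (A : Set M) (a : ι → M) (b : ι' → M) : Prop :=
  ¬ Forks A (tp L (A ∪ Set.range b) a)

/-- `α₊ ≤ DD(p)`: there is a dividing tree of depth `α` in `p`. A node of the tree at level `j < α`
is a sequence `s` of natural numbers of length `j`, and `a j s i` is the parameter `a_{s,i}`. -/
def PlusLeDD (α : Ordinal.{t}) (p : Set (ParamFormula L M ι)) : Prop :=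
  ∃ (n : Set.Iio α → ℕ) (φ : ∀ j, L.Formula (ι ⊕ Fin (n j))) (k : Set.Iio α → ℕ)
    (a : ∀ j : Set.Iio α, (Set.Iio j.1 → ℕ) → ℕ → Fin (n j) → M),
    (∀ (j : Set.Iio α) (s : Set.Iio j.1 → ℕ), KInconsistent (k j) (φ j) (a j s)) ∧
    ∀ f : Set.Iio α → ℕ,
      Consistent (p ∪ Set.range fun j : Set.Iio α =>
        inst (φ j) (a j (fun l => f ⟨l.1, lt_trans (Set.mem_Iio.1 l.2) (Set.mem_Iio.1 j.2)⟩) (f j)))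

variable (M) in
/-- The formula `φ(x, y)` has the tree property with respect to `k` in `M`. -/
def HasTreeProperty {m n : ℕ} (φ : L.Formula (Fin m ⊕ Fin n)) (k : ℕ) : Prop :=
  ∃ a : List ℕ → Fin n → M,
    (∀ s : List ℕ, KInconsistent k φ (fun i => a (s ++ [i]))) ∧
    ∀ f : ℕ → ℕ, Consistent
      (Set.range fun l : ℕ => inst φ (a ((List.range (l + 1)).map f)))

end Types

/-- A theory is simple if no formula `φ(x, y)`, with `x` and `y` finite tuples of variables, has the
tree property (in a model of the theory). -/
def IsSimple {L : FirstOrder.Language.{u, v}} (T : L.Theory) : Prop :=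
  ∀ (N : Type w) [L.Structure N] [Nonempty N] [N ⊨ T] (m n k : ℕ)
    (φ : L.Formula (Fin m ⊕ Fin n)), ¬ HasTreeProperty N φ k

/-- `M` is `κ`-saturated: every consistent set of formulas in one variable over fewer than `κ`
parameters is realized in `M`. -/
def IsSaturated (L : FirstOrder.Language.{u, v}) (M : Type w) [L.Structure M] (κ : Cardinal.{w}) : Prop :=
  ∀ A : Set M, Cardinal.mk A < κ → ∀ p : Set (ParamFormula L M (Fin 1)),
    (∀ φ ∈ p, IsOver A φ) → Consistent p → ∃ e : Fin 1 → M, ∀ φ ∈ p, Sat φ e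

/-- `M` is strongly `κ`-homogeneous: every partial elementary map of `M` whose domain has fewer than
`κ` elements extends to an automorphism of `M`. -/
def IsStronglyHomogeneous (L : FirstOrder.Language.{u, v}) (M : Type w) [L.Structure M] (κ : Cardinal.{w}) :
    Prop :=
  ∀ (S : Set M) (f : S → M), Cardinal.mk S < κ →
    (∀ φ : L.Formula S, φ.Realize (fun s : S => (s : M)) ↔ φ.Realize f) →
    ∃ g : M ≃[L] M, ∀ s : S, g s = f s

/-- `M` is a monster model of `T` with respect to `κ`: a `κ`-saturated and strongly
`κ`-homogeneous model, where `κ` is a strong limit cardinal larger than `|T|`, the number of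
formulas of the language. -/
structure IsMonster {L : FirstOrder.Language.{u, v}} (T : L.Theory) (M : Type w) [L.Structure M]
    (κ : Cardinal.{w}) : Prop where
  nonempty : Nonempty M
  model : M ⊨ T
  strongLimit : κ.IsStrongLimit
  card_lt : Cardinal.lift.{w} (max Cardinal.aleph0 L.card) < Cardinal.lift.{max u v} κ
  saturated : IsSaturated L M κ
  homogeneous : IsStronglyHomogeneous L M κ

end DividingDepth

/-! Trees are traded for linear objects. A dividing chain of length `α` for `a` over `A` consists of
tuples `e_j`, `j < α`, such that `φ_j(a, e_j)` holds and `φ_j(x, e_j)` divides over `A` together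
with all earlier `e_l`. Saturation turns a tree into a chain (`PlusLeDD.exists_divChain`), and
homogeneity turns a chain into a tree (`DivChain.plusLeDD`).

Let `e` and `e'` be chains for `a` and `b`, both over `A`. Extension and symmetry of nonforking
allow moving `e'` over `Ab`, and then `e` over `Aa`, until `ae` and `be'` are independent over `A`.
By `SDiv.union_range`, every formula of `e` then still divides after all of `be'` is added to its
base, and vice versa. So any interleaving that respects the order of each chain is a dividing chain
for `ab`. By Cantor normal forms, `α ⊕ β` is the length of such an interleaving
(`exists_isShuffle`).

The forking calculus is developed without indiscernible sequences. Its engine is `SplitRank`, which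
counts nested splittings by `k`-inconsistent families of instances of a formula and is bounded in a
simple theory. The bound gives existence (`nonForking_self`) and a version of Kim's lemma
(`not_exists_mem_of_indep_seq`): a dividing set has no common point with too many of its conjugates
along an independent sequence. Symmetry and the equality of forking and dividing follow. It also
bounds how often a formula occurs in a dividing tree, so that the depth of the tree is below `κ` and
saturation applies. -/

namespace DividingDepth

open Language

/-! ### Definable sets of possibly infinite tuples -/

section Definable

variable (L : FirstOrder.Language.{u, v}) {M : Type w} [L.Structure M]

/-- The set `X` of tuples indexed by `V` is definable with parameters from `A`. -/
def IsDef (A : Set M) {V : Type*} (X : Set (V → M)) : Prop :=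
  ∃ φ : L.Formula (V ⊕ A), ∀ e, e ∈ X ↔ φ.Realize (Sum.elim e Subtype.val)

variable {L} {A B : Set M} {V V' W : Type*}

theorem exists_realize_iff_comp (φ : L.Formula V) :
    ∃ (n : ℕ) (g : Fin n → V) (ψ : L.Formula (Fin n)), Function.Injective g ∧ ∀ e : V → M, φ.Realize e ↔ ψ.Realize (e ∘ g) := by
  classical
  let eq := φ.freeVarFinset.equivFin
  refine ⟨_, fun i => (eq.symm i : V), φ.restrictFreeVar (fun a => eq a), ?_, fun e => ?_⟩
  · exact Subtype.val_injective.comp eq.symm.injective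
  · exact (BoundedFormula.realize_restrictFreeVar e (by simp)).symm

theorem isDef_realize (φ : L.Formula V) : IsDef L A {e : V → M | φ.Realize e} :=
  ⟨φ.relabel Sum.inl, fun e => by simp [Function.comp_def]⟩

theorem isDef_realize_param (φ : L.Formula (V ⊕ W)) (c : W → M) (hc : ∀ i, c i ∈ A) :
    IsDef L A {e : V → M | φ.Realize (Sum.elim e c)} :=
  ⟨φ.relabel (Sum.map id fun i => (⟨c i, hc i⟩ : A)), fun e => by
    rw [Formula.realize_relabel, Sum.elim_comp_map]; rfl⟩

theorem IsDef.exists_finite {X : Set (V → M)} (h : IsDef L A X) :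
    ∃ (n : ℕ) (φ : L.Formula (V ⊕ Fin n)) (c : Fin n → M), (∀ i, c i ∈ A) ∧
      ∀ e, e ∈ X ↔ φ.Realize (Sum.elim e c) := by
  classical
  obtain ⟨φ, hφ⟩ := h
  let F : Finset A := (φ.freeVarFinset.image
    (fun a => (Sum.elim (fun _ => none) some a : Option A))).eraseNone
  have hF : ∀ a : A, Sum.inr a ∈ φ.freeVarFinset → a ∈ F := fun a ha => by
    simp only [F, Finset.mem_eraseNone, Finset.mem_image]
    exact ⟨_, ha, rfl⟩
  let eq := F.equivFin
  refine ⟨_, φ.restrictFreeVar (fun a => match a with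
    | ⟨Sum.inl v, _⟩ => Sum.inl v
    | ⟨Sum.inr b, hb⟩ => Sum.inr (eq ⟨b, hF b hb⟩)), fun i => ((eq.symm i : A) : M),
    fun i => (eq.symm i : A).2, fun e => ?_⟩
  rw [hφ]
  refine (BoundedFormula.realize_restrictFreeVar _ ?_).symm
  rintro ⟨v | b, hb⟩ <;> simp

theorem IsDef.mono {X : Set (V → M)} (h : IsDef L A X) (hAB : A ⊆ B) : IsDef L B X := by
  obtain ⟨φ, hφ⟩ := h
  have := isDef_realize_param φ Subtype.val (fun i => hAB i.2)
  convert this using 1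
  ext e; exact hφ e

theorem IsDef.congr {X Y : Set (V → M)} (h : IsDef L A X) (hXY : ∀ e, e ∈ Y ↔ e ∈ X) :
    IsDef L A Y := by
  rwa [show Y = X from Set.ext hXY]

theorem IsDef.compl {X : Set (V → M)} (h : IsDef L A X) : IsDef L A Xᶜ := by
  obtain ⟨φ, hφ⟩ := h
  exact ⟨φ.not, fun e => by simp [hφ]⟩

theorem IsDef.inter {X Y : Set (V → M)} (hX : IsDef L A X) (hY : IsDef L A Y) :
    IsDef L A (X ∩ Y) := by
  obtain ⟨φ, hφ⟩ := hX
  obtain ⟨ψ, hψ⟩ := hY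
  exact ⟨φ ⊓ ψ, fun e => by simp [hφ, hψ]⟩

theorem isDef_univ : IsDef L A (Set.univ : Set (V → M)) :=
  ⟨⊤, fun e => by simp⟩

theorem IsDef.iInter_finset {I : Type*} (F : Finset I) (X : I → Set (V → M))
    (h : ∀ i ∈ F, IsDef L A (X i)) : IsDef L A {e | ∀ i ∈ F, e ∈ X i} := by
  classical
  induction F using Finset.induction_on with
  | empty => exact isDef_univ.congr (by simp)
  | insert i F _ ih =>
    refine ((h i (by simp)).inter (ih fun j hj => h j (by simp [hj]))).congr fun e => ?_
    simp

theorem IsDef.preimage {X : Set (V → M)} (h : IsDef L A X) (f : V → V') :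
    IsDef L A {e : V' → M | e ∘ f ∈ X} := by
  obtain ⟨φ, hφ⟩ := h
  refine ⟨φ.relabel (Sum.map f id), fun e => ?_⟩
  rw [Formula.realize_relabel, Sum.elim_comp_map]
  exact hφ _

theorem IsDef.subst {X : Set (V ⊕ W → M)} (h : IsDef L A X) (c : W → M) (hc : ∀ i, c i ∈ A) :
    IsDef L A {e : V → M | Sum.elim e c ∈ X} := by
  obtain ⟨φ, hφ⟩ := h
  refine ⟨φ.relabel (Sum.elim (Sum.map id fun i => ⟨c i, hc i⟩) Sum.inr), fun e => ?_⟩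
  rw [Formula.realize_relabel]
  refine (hφ _).trans (iff_of_eq (congrArg _ ?_))
  ext ((_ | _) | _) <;> rfl

theorem isDef_eq (i j : V) : IsDef L A {e : V → M | e i = e j} :=
  ⟨((Term.var (Sum.inl i)).equal (Term.var (Sum.inl j))), fun e => by
    simp [Formula.realize_equal]⟩

theorem isDef_eq_const (i : V) (m : M) (hm : m ∈ A) : IsDef L A {e : V → M | e i = m} :=
  ⟨((Term.var (Sum.inl i)).equal (Term.var (Sum.inr ⟨m, hm⟩))), fun e => by
    simp [Formula.realize_equal]⟩

/-- `V` may be infinite, so the quantifier runs over the finitely many free variables of the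
formula; those outside `V` become dummies. -/
theorem IsDef.exists_left [Nonempty M] {X : Set (V ⊕ W → M)} (h : IsDef L A X) :
    IsDef L A {c : W → M | ∃ e : V → M, Sum.elim e c ∈ X} := by
  classical
  obtain ⟨φ, hφ⟩ := h
  let r : φ.freeVarFinset → (W ⊕ A) ⊕ φ.freeVarFinset := fun a => match a with
    | ⟨Sum.inl (Sum.inl v), h⟩ => Sum.inr ⟨Sum.inl (Sum.inl v), h⟩
    | ⟨Sum.inl (Sum.inr v), _⟩ => Sum.inl (Sum.inl v)
    | ⟨Sum.inr b, _⟩ => Sum.inl (Sum.inr b)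
  refine ⟨Formula.iExs φ.freeVarFinset (φ.restrictFreeVar r), fun c => ?_⟩
  rw [Formula.realize_iExs]
  constructor
  · rintro ⟨e, he⟩
    refine ⟨fun a => Sum.elim (Sum.elim e c) Subtype.val a.1, ?_⟩
    refine (BoundedFormula.realize_restrictFreeVar (Sum.elim (Sum.elim e c) Subtype.val) ?_).2
      ((hφ _).1 he)
    rintro ⟨(_ | _) | _, _⟩ <;> rfl
  · rintro ⟨i, hi⟩
    let e : V → M := fun v => if h : Sum.inl (Sum.inl v) ∈ φ.freeVarFinset then i ⟨_, h⟩
      else Classical.arbitrary M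
    refine ⟨e, (hφ _).2 ?_⟩
    refine (BoundedFormula.realize_restrictFreeVar (Sum.elim (Sum.elim e c) Subtype.val) ?_).1 hi
    rintro ⟨(v | _) | _, hv⟩
    · simp [r, e, hv]
    · rfl
    · rfl

theorem IsDef.exists_support {X : Set (V → M)} (h : IsDef L A X) :
    ∃ F : Finset V, ∀ e e' : V → M, (∀ v ∈ F, e v = e' v) → e ∈ X → e' ∈ X := by
  classical
  obtain ⟨n, φ, c, -, hφ⟩ := h.exists_finite
  obtain ⟨m, g, ψ, -, hψ⟩ := exists_realize_iff_comp (M := M) φ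
  refine ⟨(Finset.univ.image g).toLeft, fun e e' hee he => ?_⟩
  rw [hφ, hψ] at he ⊢
  convert he using 1
  ext i
  rcases hi : g i with v | w
  · simp only [Function.comp, hi, Sum.elim_inl]
    exact (hee v (by simp [← hi])).symm
  · simp [hi]

theorem IsDef.exists_of_union_range {X : Set (V → M)} {c : W → M}
    (h : IsDef L (A ∪ Set.range c) X) :
    ∃ Y : Set (W ⊕ V → M), IsDef L A Y ∧ ∀ e, e ∈ X ↔ Sum.elim c e ∈ Y := by
  obtain ⟨φ, hφ⟩ := h
  have hr : ∀ b : (A ∪ Set.range c : Set M), ∃ r : (W ⊕ V) ⊕ A, ∀ e : V → M,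
      Sum.elim (Sum.elim c e) Subtype.val r = b := by
    rintro ⟨b, hb | ⟨w, rfl⟩⟩
    · exact ⟨Sum.inr ⟨b, hb⟩, fun e => rfl⟩
    · exact ⟨Sum.inl (Sum.inl w), fun e => rfl⟩
  choose r hr using hr
  refine ⟨_, ⟨φ.relabel (Sum.elim (Sum.inl ∘ Sum.inr) r), fun e => Iff.rfl⟩, fun e => ?_⟩
  rw [hφ]
  change _ ↔ Formula.Realize _ _
  rw [Formula.realize_relabel]
  refine iff_of_eq (congrArg φ.Realize ?_)
  ext (_ | b)
  · rfl
  · exact (hr b e).symm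

/-- `σ` fixes `A` pointwise. -/
def Fixes (A : Set M) (σ : M ≃[L] M) : Prop := ∀ a ∈ A, σ a = a

theorem Fixes.symm {σ : M ≃[L] M} (h : Fixes A σ) : Fixes A σ.symm := fun a ha => by
  have := σ.symm_apply_apply a
  rwa [h a ha] at this

theorem Fixes.comp {σ τ : M ≃[L] M} (h : Fixes A σ) (h' : Fixes A τ) : Fixes A (σ.comp τ) :=
  fun a ha => by rw [Equiv.comp_apply, h' a ha, h a ha]

theorem Fixes.mono {σ : M ≃[L] M} (h : Fixes B σ) (hAB : A ⊆ B) : Fixes A σ :=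
  fun a ha => h a (hAB ha)

theorem IsDef.mem_iff_of_fixes {X : Set (V → M)} (h : IsDef L A X) {σ : M ≃[L] M}
    (hσ : Fixes A σ) (e : V → M) : σ ∘ e ∈ X ↔ e ∈ X := by
  obtain ⟨φ, hφ⟩ := h
  rw [hφ, hφ, ← StrongHomClass.realize_formula σ φ (v := Sum.elim e Subtype.val), Sum.comp_elim]
  have : σ ∘ (Subtype.val : A → M) = Subtype.val := by
    ext a; exact hσ a a.2
  rw [this]

theorem IsDef.image {X : Set (V → M)} (h : IsDef L A X) (σ : M ≃[L] M)
    (hσ : ∀ a ∈ A, σ a ∈ B) : IsDef L B {e : V → M | σ.symm ∘ e ∈ X} := by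
  obtain ⟨φ, hφ⟩ := h
  refine (isDef_realize_param φ (fun a : A => σ a) fun a => hσ a a.2).congr fun e => ?_
  rw [Set.mem_ofPred_eq, hφ, Set.mem_ofPred_eq, ← StrongHomClass.realize_formula σ φ, Sum.comp_elim]
  have : σ ∘ σ.symm ∘ e = e := by
    ext a; simp
  rw [this]; rfl

variable (L) in
/-- Every `A`-definable set that contains `c` contains `d`. -/
def TpEq (A : Set M) (c d : V → M) : Prop := ∀ X, IsDef L A X → c ∈ X → d ∈ X

theorem TpEq.iff {c d : V → M} (h : TpEq L A c d) {X : Set (V → M)} (hX : IsDef L A X) :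
    c ∈ X ↔ d ∈ X :=
  ⟨h X hX, fun hd => by_contra fun hc => h _ hX.compl hc hd⟩

theorem tpEq_comp_of_fixes {σ : M ≃[L] M} (hσ : Fixes A σ) (c : V → M) : TpEq L A c (σ ∘ c) :=
  fun _ hX hc => (hX.mem_iff_of_fixes hσ c).2 hc

theorem IsOver.isDef {φ : ParamFormula L M V} (h : IsOver A φ) :
    IsDef L A {e | Sat φ e} := by
  obtain ⟨ψ, rfl⟩ := h
  refine ⟨ψ, fun e => ?_⟩
  rw [Set.mem_ofPred_eq, Sat, Formula.realize_relabel, Sum.elim_comp_map]; rfl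

theorem IsDef.exists_isOver {X : Set (V → M)} (h : IsDef L A X) :
    ∃ φ : ParamFormula L M V, IsOver A φ ∧ ∀ e, e ∈ X ↔ Sat φ e := by
  obtain ⟨ψ, hψ⟩ := h
  refine ⟨_, ⟨ψ, rfl⟩, fun e => ?_⟩
  rw [hψ, Sat, Formula.realize_relabel, Sum.elim_comp_map]; rfl

theorem sat_inst {n : ℕ} (φ : L.Formula (V ⊕ Fin n)) (c : Fin n → M) (e : V → M) :
    Sat (inst φ c) e ↔ φ.Realize (Sum.elim e c) := by
  rw [Sat, inst, Formula.realize_relabel, Sum.elim_comp_map]; rfl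

theorem tp_eq_iff {c d : V → M} : tp L A c = tp L A d ↔ TpEq L A c d := by
  constructor
  · intro h X hX hc
    obtain ⟨φ, hφ, hs⟩ := hX.exists_isOver
    have : φ ∈ tp L A d := h ▸ ⟨hφ, (hs _).1 hc⟩
    exact (hs _).2 this.2
  · intro h
    ext φ
    constructor
    · rintro ⟨h1, h2⟩
      exact ⟨h1, h _ (IsOver.isDef h1) h2⟩
    · rintro ⟨h1, h2⟩
      exact ⟨h1, (h.iff (IsOver.isDef h1)).2 h2⟩

end Definable

/-! ### Smallness relative to `κ` across universes -/

section Small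

/-- The type `V`, in an arbitrary universe, has fewer than `κ` elements. -/
def IsSmall (κ : Cardinal.{w}) (V : Type*) : Prop :=
  ∃ V₀ : Type w, Cardinal.mk V₀ < κ ∧ Nonempty (V ↪ V₀)

variable {κ : Cardinal.{w}} {V V' : Type*}

theorem isSmall_of_mk_lt {V : Type w} (h : Cardinal.mk V < κ) : IsSmall κ V :=
  ⟨V, h, ⟨Function.Embedding.refl V⟩⟩

theorem IsSmall.mk_lt {V : Type w} (h : IsSmall κ V) : Cardinal.mk V < κ := by
  obtain ⟨V₀, h, ⟨f⟩⟩ := h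
  exact (Cardinal.mk_le_of_injective f.injective).trans_lt h

theorem IsSmall.of_injective (h : IsSmall κ V) {f : V' → V} (hf : Function.Injective f) :
    IsSmall κ V' := by
  obtain ⟨V₀, h, ⟨g⟩⟩ := h
  exact ⟨V₀, h, ⟨⟨g ∘ f, g.injective.comp hf⟩⟩⟩

theorem IsSmall.of_surjective (h : IsSmall κ V) {f : V → V'} (hf : Function.Surjective f) :
    IsSmall κ V' :=
  h.of_injective (Function.injective_surjInv hf)

theorem IsSmall.range {M : Type*} (h : IsSmall κ V) (c : V → M) : IsSmall κ (Set.range c) :=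
  h.of_surjective Set.rangeFactorization_surjective

theorem IsSmall.subset {M : Type*} {A B : Set M} (h : IsSmall κ B) (hAB : A ⊆ B) : IsSmall κ A :=
  h.of_injective (Set.inclusion_injective hAB)

theorem IsSmall.sum (hκ : Cardinal.aleph0 ≤ κ) (h : IsSmall κ V) (h' : IsSmall κ V') :
    IsSmall κ (V ⊕ V') := by
  obtain ⟨V₀, h, ⟨g⟩⟩ := h
  obtain ⟨V₁, h', ⟨g'⟩⟩ := h'
  exact ⟨V₀ ⊕ V₁, by simpa using Cardinal.add_lt_of_lt hκ h h', ⟨g.sumMap g'⟩⟩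

theorem IsSmall.prod (hκ : Cardinal.aleph0 ≤ κ) (h : IsSmall κ V) (h' : IsSmall κ V') :
    IsSmall κ (V × V') := by
  obtain ⟨V₀, h, ⟨g⟩⟩ := h
  obtain ⟨V₁, h', ⟨g'⟩⟩ := h'
  exact ⟨V₀ × V₁, by simpa using Cardinal.mul_lt_of_lt hκ h h', ⟨g.prodMap g'⟩⟩

theorem IsSmall.union (hκ : Cardinal.aleph0 ≤ κ) {M : Type*} {A B : Set M} (h : IsSmall κ A)
    (h' : IsSmall κ B) : IsSmall κ (A ∪ B : Set M) := by
  refine (h.sum hκ h').of_surjective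
    (f := Sum.elim (fun a => ⟨a, Or.inl a.2⟩) (fun b => ⟨b, Or.inr b.2⟩)) ?_
  rintro ⟨a, ha | ha⟩
  · exact ⟨Sum.inl ⟨a, ha⟩, rfl⟩
  · exact ⟨Sum.inr ⟨a, ha⟩, rfl⟩

theorem isSmall_of_countable (hκ : Cardinal.aleph0 < κ) [Countable V] : IsSmall κ V := by
  obtain ⟨f, hf⟩ := exists_injective_nat V
  exact ⟨ULift ℕ, by simpa using hκ, ⟨⟨fun a => ⟨f a⟩, fun a b h => hf (ULift.up_injective h)⟩⟩⟩

theorem IsSmall.sigma_fin (hκ : Cardinal.aleph0 < κ) (h : IsSmall κ V) (n : V → ℕ) :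
    IsSmall κ (Σ j, Fin (n j)) := by
  refine (h.prod hκ.le (isSmall_of_countable hκ (V := ℕ))).of_injective
    (f := fun p => (p.1, (p.2 : ℕ))) ?_
  rintro ⟨i, a⟩ ⟨j, b⟩ h
  simp only [Prod.mk.injEq] at h
  obtain ⟨rfl, h⟩ := h
  rw [Fin.ext h]

theorem isSmall_of_lift_lt {V : Type x}
    (h : Cardinal.lift.{w} (Cardinal.mk V) < Cardinal.lift.{x} κ) :
    IsSmall κ V := by
  obtain ⟨c, hc⟩ := Cardinal.mem_range_lift_of_le h.le
  induction c using Cardinal.inductionOn with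
  | _ V₀ =>
    refine ⟨V₀, ?_, ?_⟩
    · rw [← hc] at h
      exact Cardinal.lift_lt.1 h
    · obtain ⟨f⟩ := Cardinal.lift_mk_eq'.1 hc
      exact ⟨f.symm.toEmbedding⟩

end Small

/-! ### Homogeneity and saturation for small tuples -/

section Monster

variable {L : FirstOrder.Language.{u, v}} {T : L.Theory} {M : Type w} [L.Structure M]
  {κ : Cardinal.{w}} {A B : Set M} {V : Type*}

theorem IsMonster.aleph0_lt (hM : IsMonster T M κ) : Cardinal.aleph0 < κ := by
  have h := (le_max_left Cardinal.aleph0 L.card)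
  have h2 := (Cardinal.lift_le.{w}.2 h).trans_lt hM.card_lt
  rw [Cardinal.lift_aleph0] at h2
  exact Cardinal.aleph0_lt_lift.1 h2

/-- Tuples of small length with the same type over a small set are conjugate. -/
theorem IsMonster.exists_fixes_of_tpEq (hM : IsMonster T M κ) (hA : IsSmall κ A) {c d : V → M}
    (hc : IsSmall κ (Set.range c)) (h : TpEq L A c d) : ∃ σ : M ≃[L] M, Fixes A σ ∧ σ ∘ c = d := by
  have hS := hA.union hM.aleph0_lt.le hc
  have hr : ∀ s : (A ∪ Set.range c : Set M), ∃ r : V ⊕ A, Sum.elim c Subtype.val r = s := by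
    rintro ⟨s, hs | ⟨v, rfl⟩⟩
    · exact ⟨Sum.inr ⟨s, hs⟩, rfl⟩
    · exact ⟨Sum.inl v, rfl⟩
  choose r hr using hr
  have key : ∀ φ : L.Formula (V ⊕ A),
      φ.Realize (Sum.elim c Subtype.val) ↔ φ.Realize (Sum.elim d Subtype.val) := fun φ =>
    h.iff (X := {e | φ.Realize (Sum.elim e Subtype.val)}) ⟨φ, fun e => Iff.rfl⟩
  -- An element may have several names, as `c` can repeat entries or meet `A`; equality formulas
  -- make the choice of the name `r` irrelevant.
  have heq : ∀ a b : V ⊕ A, Sum.elim c Subtype.val a = Sum.elim c Subtype.val b →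
      Sum.elim d Subtype.val a = Sum.elim d Subtype.val b := fun a b hab => by
    have := key ((Term.var a).equal (Term.var b))
    simp only [Formula.realize_equal, Term.realize_var] at this
    exact this.1 hab
  obtain ⟨σ, hσ⟩ := hM.homogeneous (A ∪ Set.range c)
    (fun s => Sum.elim d Subtype.val (r s)) hS.mk_lt (fun φ => by
      have := key (φ.relabel r)
      rw [Formula.realize_relabel, Formula.realize_relabel] at this
      rw [show Sum.elim c Subtype.val ∘ r = Subtype.val from funext hr] at this
      exact this)
  refine ⟨σ, fun a ha => ?_, funext fun v => ?_⟩
  · rw [hσ ⟨a, Or.inl ha⟩]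
    exact heq _ (Sum.inr ⟨a, ha⟩) (hr _)
  · rw [Function.comp, hσ ⟨c v, Or.inr ⟨v, rfl⟩⟩]
    exact heq _ (Sum.inl v) (hr _)

/-- A tuple of small length that is locally conjugate to another one is conjugate to it. -/
theorem IsMonster.exists_fixes_of_finset (hM : IsMonster T M κ) (hA : IsSmall κ A) {c d : V → M}
    (hc : IsSmall κ (Set.range c))
    (h : ∀ F : Finset V, ∃ σ : M ≃[L] M, Fixes A σ ∧ ∀ v ∈ F, σ (c v) = d v) :
    ∃ σ : M ≃[L] M, Fixes A σ ∧ σ ∘ c = d := by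
  refine hM.exists_fixes_of_tpEq hA hc fun X hX hcX => ?_
  obtain ⟨F, hF⟩ := hX.exists_support
  obtain ⟨σ, hσ, hσF⟩ := h F
  exact hF _ _ hσF (tpEq_comp_of_fixes hσ c X hX hcX)

/-- Saturation for types in one variable, in terms of definable sets. -/
theorem IsMonster.exists_mem_of_fip_one (hM : IsMonster T M κ) (hA : IsSmall κ A)
    {𝒳 : Set (Set (Fin 1 → M))} (hdef : ∀ X ∈ 𝒳, IsDef L A X)
    (hfip : ∀ F : Finset (Set (Fin 1 → M)), ↑F ⊆ 𝒳 → ∃ e, ∀ X ∈ F, e ∈ X) :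
    ∃ e, ∀ X ∈ 𝒳, e ∈ X := by
  classical
  choose! φ hφ hs using fun X hX => (hdef X hX).exists_isOver
  obtain ⟨e, he⟩ := hM.saturated A hA.mk_lt (φ '' 𝒳) (by
    rintro _ ⟨X, hX, rfl⟩
    exact hφ X hX) (by
    intro q hq hqf
    have hq' : ∀ θ, θ ∈ q → ∃ X, X ∈ 𝒳 ∧ φ X = θ := fun θ hθ => hq hθ
    choose! g hg hgφ using hq'
    obtain ⟨e, he⟩ := hfip (hqf.toFinset.image g) (by
      intro X hX
      simp only [Finset.coe_image, Set.Finite.coe_toFinset] at hX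
      obtain ⟨θ, hθ, rfl⟩ := hX
      exact hg θ hθ)
    refine ⟨e, fun θ hθ => ?_⟩
    rw [← hgφ θ hθ]
    exact (hs _ (hg θ hθ) e).1 (he _ (Finset.mem_image_of_mem g (by simpa using hθ))))
  exact ⟨e, fun X hX => (hs X hX e).2 (he _ ⟨X, hX, rfl⟩)⟩

/-- A family of sets, each definable over the small set `A`, of tuples of small length has a common
point if every finite subfamily has one. -/
theorem IsMonster.exists_mem_of_fip (hM : IsMonster T M κ) (hA : IsSmall κ A)
    (hV : IsSmall κ V) {𝒳 : Set (Set (V → M))} (hdef : ∀ X ∈ 𝒳, IsDef L A X)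
    (hfip : ∀ F : Finset (Set (V → M)), ↑F ⊆ 𝒳 → ∃ e, ∀ X ∈ F, e ∈ X) :
    ∃ e, ∀ X ∈ 𝒳, e ∈ X := by
  classical
  have := hM.nonempty
  -- Saturation is given for one variable only. `G` is a partial assignment of values to variables,
  -- and `P G` says that it is finitely compatible with `𝒳`. Saturation extends it by one variable,
  -- so a maximal one is total.
  let P : Set (V × M) → Prop := fun G => ∀ (F : Finset (Set (V → M))) (K : Finset (V × M)),
    ↑F ⊆ 𝒳 → ↑K ⊆ G → ∃ e : V → M, (∀ X ∈ F, e ∈ X) ∧ ∀ p ∈ K, e p.1 = p.2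
  obtain ⟨G, hG⟩ := zorn_subset {G | P G} (by
    intro c hc hchain
    refine ⟨⋃₀ c, ?_, fun s hs => Set.subset_sUnion_of_mem hs⟩
    intro F K hF hK
    rcases c.eq_empty_or_nonempty with rfl | hne
    · obtain ⟨e, he⟩ := hfip F hF
      refine ⟨e, he, fun p hp => ?_⟩
      simpa using hK hp
    · obtain ⟨G, hGc, hKG⟩ := DirectedOn.exists_mem_subset_of_finset_subset_biUnion
        (s := K) (f := id) hne hchain.directedOn (by simpa [Set.sUnion_eq_biUnion] using hK)
      exact hc hGc F K hF hKG)
  have hGP : P G := hG.prop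
  have hfun : ∀ v m m', (v, m) ∈ G → (v, m') ∈ G → m = m' := fun v m m' h h' => by
    obtain ⟨e, -, he⟩ := hGP ∅ {(v, m), (v, m')} (by simp) (by
      intro p hp
      simp only [Finset.coe_insert, Finset.coe_singleton, Set.mem_insert_iff,
        Set.mem_singleton_iff] at hp
      rcases hp with rfl | rfl <;> assumption)
    exact (he (v, m) (by simp)).symm.trans (he (v, m') (by simp))
  have htot : ∀ v, ∃ m, (v, m) ∈ G := by
    intro v
    have hGs : IsSmall κ (Prod.snd '' G : Set M) := by
      have : IsSmall κ G := hV.of_injective (f := fun p : G => p.1.1) (by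
        rintro ⟨⟨v, m⟩, h⟩ ⟨⟨v', m'⟩, h'⟩ hv
        obtain rfl : v = v' := hv
        obtain rfl := hfun v m m' h h'
        rfl)
      exact this.of_surjective (f := fun p => ⟨p.1.2, ⟨p.1, p.2, rfl⟩⟩) (by
        rintro ⟨_, p, hp, rfl⟩
        exact ⟨⟨p, hp⟩, rfl⟩)
    have hS := hA.union hM.aleph0_lt.le hGs
    let Y : Finset (Set (V → M)) × Finset (V × M) → Set (Fin 1 → M) := fun q =>
      {u | ∃ e : V → M, ((∀ X ∈ q.1, e ∈ X) ∧ ∀ p ∈ q.2, e p.1 = p.2) ∧ e v = u 0}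
    obtain ⟨u, hu⟩ := hM.exists_mem_of_fip_one hS
      (𝒳 := Y '' {q | ↑q.1 ⊆ 𝒳 ∧ ↑q.2 ⊆ G}) (by
        rintro _ ⟨q, ⟨h1, h2⟩, rfl⟩
        have hq1 : IsDef L (A ∪ Prod.snd '' G) {e : V → M | ∀ X ∈ q.1, e ∈ X} :=
          IsDef.iInter_finset q.1 id fun X hX => (hdef X (h1 hX)).mono Set.subset_union_left
        have hq2 : IsDef L (A ∪ Prod.snd '' G) {e : V → M | ∀ p ∈ q.2, e p.1 = p.2} :=
          IsDef.iInter_finset q.2 (fun p => {e : V → M | e p.1 = p.2}) fun p hp =>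
            isDef_eq_const _ _ (Or.inr ⟨p, h2 hp, rfl⟩)
        have h3 := ((hq1.inter hq2).preimage (Sum.inl : V → V ⊕ Fin 1)).inter
          (isDef_eq (Sum.inl v) (Sum.inr 0))
        exact h3.exists_left.congr fun u => Iff.rfl) (by
        intro F hF
        have hF' : ∀ X, X ∈ F → ∃ q : Finset (Set (V → M)) × Finset (V × M),
            (↑q.1 ⊆ 𝒳 ∧ ↑q.2 ⊆ G) ∧ Y q = X := fun X hX => hF hX
        choose! q hq hqY using hF'
        obtain ⟨e, he1, he2⟩ := hGP (F.biUnion fun X => (q X).1) (F.biUnion fun X => (q X).2)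
          (by simpa using fun X hX => (hq X hX).1) (by simpa using fun X hX => (hq X hX).2)
        refine ⟨fun _ => e v, fun X hX => ?_⟩
        rw [← hqY X hX]
        refine ⟨e, ⟨fun Z hZ => he1 Z ?_, fun p hp => he2 p ?_⟩, rfl⟩
        · exact Finset.mem_biUnion.2 ⟨X, hX, hZ⟩
        · exact Finset.mem_biUnion.2 ⟨X, hX, hp⟩)
    refine ⟨u 0, ?_⟩
    have hle : P (insert (v, u 0) G) := by
      intro F K hF hK
      obtain ⟨e, ⟨he1, he2⟩, he3⟩ := hu _ ⟨(F, K.erase (v, u 0)), ⟨hF, by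
        intro p hp
        simp only [Finset.coe_erase, Set.mem_sdiff, Finset.mem_coe, Set.mem_singleton_iff] at hp
        exact (hK hp.1).resolve_left hp.2⟩, rfl⟩
      refine ⟨e, he1, fun p hp => ?_⟩
      by_cases hpv : p = (v, u 0)
      · rw [hpv]; exact he3
      · exact he2 p (Finset.mem_erase.2 ⟨hpv, hp⟩)
    exact hG.le_of_ge hle (Set.subset_insert _ _) (Set.mem_insert _ _)
  choose e he using htot
  refine ⟨e, fun X hX => ?_⟩
  obtain ⟨F, hF⟩ := (hdef X hX).exists_support
  obtain ⟨e', he1, he2⟩ := hGP {X} (F.image fun v => (v, e v)) (by simpa using hX) (by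
    intro p hp
    simp only [Finset.coe_image, Set.mem_image] at hp
    obtain ⟨v, -, rfl⟩ := hp
    exact he v)
  refine hF e' e (fun v hv => ?_) (he1 X (by simp))
  exact he2 (v, e v) (Finset.mem_image.2 ⟨v, hv, rfl⟩)

end Monster

/-! ### An abstract splitting rank -/

section SplitRank

variable {E : Type*}

/-- `X` has rank at least `n` with respect to the splitting families in `G`. -/
def SplitRank (G : Set (ℕ → Set E)) : ℕ → Set E → Prop
  | 0, X => X.Nonempty
  | n + 1, X => ∃ Z ∈ G, ∀ i, SplitRank G n (X ∩ Z i)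

/-- A set of families is closed under passing to subfamilies. -/
def ReindexClosed (G : Set (ℕ → Set E)) : Prop :=
  ∀ Z ∈ G, ∀ g : ℕ → ℕ, Function.Injective g → Z ∘ g ∈ G

variable {G : Set (ℕ → Set E)} {n : ℕ} {X Y : Set E}

theorem SplitRank.mono (h : SplitRank G n X) (hXY : X ⊆ Y) : SplitRank G n Y := by
  induction n generalizing X Y with
  | zero => exact Set.Nonempty.mono hXY h
  | succ n ih =>
    obtain ⟨Z, hZ, h⟩ := h
    exact ⟨Z, hZ, fun i => ih (h i) (Set.inter_subset_inter_left _ hXY)⟩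

theorem SplitRank.nonempty (h : SplitRank G n X) : X.Nonempty := by
  induction n generalizing X with
  | zero => exact h
  | succ n ih =>
    obtain ⟨Z, hZ, h⟩ := h
    exact (ih (h 0)).mono Set.inter_subset_left

/-- Any map from `ℕ` to a finite type is constant on a subsequence. -/
theorem exists_injective_const {J : Type*} [Finite J] (f : ℕ → J) :
    ∃ (j : J) (g : ℕ → ℕ), Function.Injective g ∧ ∀ i, f (g i) = j := by
  obtain ⟨j, hj⟩ := Finite.exists_infinite_fiber f
  exact ⟨j, fun i => (Infinite.natEmbedding (f ⁻¹' {j}) i : ℕ),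
    Subtype.val_injective.comp (Function.Embedding.injective _),
    fun i => (Infinite.natEmbedding (f ⁻¹' {j}) i).2⟩

/-- Each branch of the splitting survives in some piece of the cover; by pigeonhole infinitely many
branches use the same piece, and the family is thinned to these. -/
theorem SplitRank.exists_inter {J : Type*} [Finite J] (hG : ReindexClosed G)
    (h : SplitRank G n X) (Y : J → Set E) (hY : X ⊆ ⋃ j, Y j) : ∃ j, SplitRank G n (X ∩ Y j) := by
  induction n generalizing X with
  | zero =>
    obtain ⟨e, he⟩ := h
    obtain ⟨j, hj⟩ := Set.mem_iUnion.1 (hY he)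
    exact ⟨j, e, he, hj⟩
  | succ n ih =>
    obtain ⟨Z, hZ, h⟩ := h
    choose f hf using fun i => ih (h i) (Set.inter_subset_left.trans hY)
    obtain ⟨j, g, hg, hgj⟩ := exists_injective_const f
    refine ⟨j, Z ∘ g, hG Z hZ g hg, fun i => ?_⟩
    have := hf (g i)
    rw [hgj] at this
    rwa [Set.inter_right_comm] at this

/-- If the first splitting comes from `G j`, lower `n j` by one and apply induction to each branch.
Infinitely many branches return the same index `j'`: for `j' = j` the splitting restores the lost
unit, and otherwise a single branch already has the required rank. -/
theorem SplitRank.exists_of_iUnion {J : Type*} [Fintype J] [Nonempty J]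
    {G : J → Set (ℕ → Set E)} (hG : ∀ j, ReindexClosed (G j)) (n : J → ℕ) {X : Set E}
    (h : SplitRank (⋃ j, G j) (∑ j, n j) X) : ∃ j, SplitRank (G j) (n j) X := by
  classical
  generalize hN : ∑ j, n j = N at h
  induction N generalizing n X with
  | zero =>
    obtain ⟨j⟩ := ‹Nonempty J›
    refine ⟨j, ?_⟩
    rw [Finset.sum_eq_zero_iff.1 hN j (Finset.mem_univ j)]
    exact h
  | succ N ih =>
    have hne := h.nonempty
    obtain ⟨Z, hZ, h⟩ := h
    obtain ⟨j, hj⟩ := Set.mem_iUnion.1 hZ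
    rcases hnj : n j with _ | r
    · exact ⟨j, by rw [hnj]; exact hne⟩
    have hsum : ∑ i, Function.update n j r i = N := by
      rw [Finset.sum_update_of_mem (Finset.mem_univ j)]
      rw [← Finset.add_sum_erase _ _ (Finset.mem_univ j), hnj, Finset.erase_eq] at hN
      omega
    choose f hf using fun i => ih (Function.update n j r) hsum (h i)
    obtain ⟨j', g, hg, hgj⟩ := exists_injective_const f
    refine ⟨j', ?_⟩
    by_cases hjj : j' = j
    · subst hjj
      rw [hnj]
      refine ⟨Z ∘ g, hG _ Z hj g hg, fun i => ?_⟩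
      have := hf (g i)
      rwa [hgj, Function.update_self] at this
    · have h2 := hf (g 0)
      rw [hgj, Function.update_of_ne hjj] at h2
      exact h2.mono Set.inter_subset_left

theorem SplitRank.preimage (h : SplitRank G n X) (σ : E ≃ E)
    (hσ : ∀ Z ∈ G, (fun i => σ ⁻¹' Z i) ∈ G) : SplitRank G n (σ ⁻¹' X) := by
  induction n generalizing X with
  | zero => exact h.preimage σ.surjective
  | succ n ih =>
    obtain ⟨Z, hZ, h⟩ := h
    exact ⟨_, hσ Z hZ, fun i => ih (h i)⟩

end SplitRank

/-! ### The rank of a formula is bounded in a simple theory -/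

section Split

variable {L : FirstOrder.Language.{u, v}} {M : Type w} [L.Structure M] {ι : Type*}

variable (M) in
/-- The `k`-inconsistent families of instances of a formula. -/
def splitFam (P : Σ n, L.Formula (ι ⊕ Fin n)) (k : ℕ) : Set (ℕ → Set (ι → M)) :=
  {Z | ∃ c : ℕ → Fin P.1 → M, KInconsistent k P.2 c ∧
    ∀ i, Z i = {e | P.2.Realize (Sum.elim e (c i))}}

theorem KInconsistent.comp_injective {k n : ℕ} {φ : L.Formula (ι ⊕ Fin n)} {c : ℕ → Fin n → M}
    (h : KInconsistent k φ c) {g : ℕ → ℕ} (hg : Function.Injective g) :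
    KInconsistent k φ (c ∘ g) := by
  classical
  intro s hs ⟨e, he⟩
  exact h (s.image g) (by rw [Finset.card_image_of_injective _ hg, hs]) ⟨e, by simpa using he⟩

theorem reindexClosed_splitFam (P : Σ n, L.Formula (ι ⊕ Fin n)) (k : ℕ) :
    ReindexClosed (splitFam M P k) := by
  rintro Z ⟨c, hc, hZ⟩ g hg
  exact ⟨c ∘ g, hc.comp_injective hg, fun i => hZ (g i)⟩

/-- The action of an automorphism on tuples. -/
def tupleEquiv (σ : M ≃[L] M) : (ι → M) ≃ (ι → M) := Equiv.arrowCongr (Equiv.refl ι) σ.toEquiv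

theorem tupleEquiv_apply (σ : M ≃[L] M) (e : ι → M) : tupleEquiv σ e = σ ∘ e := rfl

theorem realize_elim_comp {W : Type*} (φ : L.Formula (ι ⊕ W)) (σ : M ≃[L] M) (e : ι → M)
    (c : W → M) :
    φ.Realize (Sum.elim (σ ∘ e) c) ↔ φ.Realize (Sum.elim e (σ.symm ∘ c)) := by
  rw [← StrongHomClass.realize_formula σ φ (v := Sum.elim e (σ.symm ∘ c)), Sum.comp_elim]
  have : σ ∘ σ.symm ∘ c = c := by ext a; simp
  rw [this]

theorem splitFam_preimage (P : Σ n, L.Formula (ι ⊕ Fin n)) (k : ℕ) (σ : M ≃[L] M) :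
    ∀ Z ∈ splitFam M P k, (fun i => tupleEquiv σ ⁻¹' Z i) ∈ splitFam M P k := by
  rintro Z ⟨c, hc, hZ⟩
  refine ⟨fun i => σ.symm ∘ c i, ?_, fun i => ?_⟩
  · intro s hs ⟨e, he⟩
    refine hc s hs ⟨σ ∘ e, fun i hi => ?_⟩
    rw [sat_inst, realize_elim_comp, ← sat_inst]
    exact he i hi
  · ext e
    simp only [hZ]
    exact realize_elim_comp _ _ _ _

theorem SplitRank.exists_tree [Nonempty M] {n k N : ℕ} {φ : L.Formula (ι ⊕ Fin n)} {X : Set (ι → M)}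
    (h : SplitRank (splitFam M ⟨n, φ⟩ k) N X) : ∃ a : List ℕ → Fin n → M,
      (∀ s : List ℕ, s.length < N → KInconsistent k φ (fun i => a (s ++ [i]))) ∧
      ∀ s : List ℕ, s.length ≤ N →
        ∃ e ∈ X, ∀ l < s.length, φ.Realize (Sum.elim e (a (s.take (l + 1)))) := by
  classical
  induction N generalizing X with
  | zero =>
    obtain ⟨e, he⟩ := h
    refine ⟨fun _ _ => Classical.arbitrary M, by simp, fun s hs => ⟨e, he, fun l hl => ?_⟩⟩
    omega
  | succ N ih =>
    have hne := h.nonempty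
    obtain ⟨Z, ⟨c, hc, hZ⟩, h⟩ := h
    choose a ha ha' using fun i => ih (h i)
    -- The value at the root is never used: parameters label the nonempty nodes.
    refine ⟨fun s => match s with
      | [] => c 0
      | i :: s => if s = [] then c i else a i s, fun s hs => ?_, fun s hs => ?_⟩
    · rcases s with _ | ⟨i, s⟩
      · simpa using hc
      · have := ha i s (by simpa using hs)
        simpa using this
    · rcases s with _ | ⟨i, s⟩
      · obtain ⟨e, he⟩ := hne
        exact ⟨e, he, by simp⟩
      · obtain ⟨e, ⟨he, heZ⟩, hes⟩ := ha' i s (by simpa using hs)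
        refine ⟨e, he, fun l hl => ?_⟩
        rcases l with _ | l
        · rw [hZ] at heZ
          simpa using heZ
        · have hl' : l < s.length := by simpa using hl
          have hne : s.take (l + 1) ≠ [] := by
            intro h0
            have := congrArg List.length h0
            simp at this
            subst this; simp at hl'
          simp only [List.take_succ_cons, hne, if_false]
          exact hes l hl'

/-- In a simple theory, every rank is finite. -/
theorem exists_not_splitRank {T : L.Theory} {κ : Cardinal.{w}} (hM : IsMonster T M κ)
    (hT : IsSimple.{u, v, w} T) (P : Σ n, L.Formula (ι ⊕ Fin n)) (k : ℕ) :
    ∃ N, ¬ SplitRank (splitFam M P k) N Set.univ := by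
  classical
  obtain ⟨n, φ⟩ := P
  have := hM.nonempty
  have := hM.model
  by_contra! hrank
  -- Compactness: unbounded rank gives trees of every finite height, hence an infinite one. `cK`
  -- expresses the inconsistency at a node and `cP` the consistency of a finite path.
  let cK : List ℕ × Finset ℕ → Set (List ℕ × Fin n → M) := fun q =>
    {v | ¬ ∃ e : ι → M, ∀ i ∈ q.2, φ.Realize (Sum.elim e fun r => v (q.1 ++ [i], r))}
  let cP : List ℕ → Set (List ℕ × Fin n → M) := fun s =>
    {v | ∃ e : ι → M, ∀ l ∈ Finset.range s.length,
      φ.Realize (Sum.elim e fun r => v (s.take (l + 1), r))}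
  have hbase : ∀ s : List ℕ, IsDef L (∅ : Set M)
      {w : ι ⊕ (List ℕ × Fin n) → M |
        φ.Realize (Sum.elim (w ∘ Sum.inl) fun r => w (Sum.inr (s, r)))} := by
    intro s
    refine ((isDef_realize φ).preimage (Sum.map id fun r => (s, r))).congr fun w => ?_
    refine iff_of_eq (congrArg φ.Realize ?_)
    ext (_ | _) <;> rfl
  obtain ⟨v, hv⟩ := hM.exists_mem_of_fip (A := ∅) (isSmall_of_countable hM.aleph0_lt)
    (V := List ℕ × Fin n) (isSmall_of_countable hM.aleph0_lt)
    (𝒳 := cK '' {q | q.2.card = k} ∪ Set.range cP) (by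
      rintro _ (⟨q, hq, rfl⟩ | ⟨s, rfl⟩)
      · exact (IsDef.exists_left (IsDef.iInter_finset q.2 _ fun i _ => hbase (q.1 ++ [i]))).compl
      · exact IsDef.exists_left (IsDef.iInter_finset (Finset.range s.length) _
          fun l _ => hbase (s.take (l + 1)))) (by
      intro F hF
      have hb : ∀ X ∈ F, ∃ N : ℕ,
          (∃ q : List ℕ × Finset ℕ, q.2.card = k ∧ q.1.length < N ∧ X = cK q) ∨
          ∃ s : List ℕ, s.length ≤ N ∧ X = cP s := by
        intro X hX
        rcases hF hX with ⟨q, hq, rfl⟩ | ⟨s, rfl⟩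
        · exact ⟨q.1.length + 1, Or.inl ⟨q, hq, Nat.lt_succ_self _, rfl⟩⟩
        · exact ⟨s.length, Or.inr ⟨s, le_rfl, rfl⟩⟩
      choose! N hN using hb
      obtain ⟨a, ha, ha'⟩ := (hrank (F.sup N)).exists_tree
      refine ⟨fun p => a p.1 p.2, fun X hX => ?_⟩
      have hle := Finset.le_sup (f := N) hX
      rcases hN X hX with ⟨q, hq, hlt, rfl⟩ | ⟨s, hs, rfl⟩
      · rintro ⟨e, he⟩
        exact ha q.1 (hlt.trans_le hle) q.2 hq ⟨e, fun i hi => (sat_inst _ _ _).2 (he i hi)⟩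
      · obtain ⟨e, -, he⟩ := ha' s (hs.trans hle)
        exact ⟨e, fun l hl => he l (Finset.mem_range.1 hl)⟩)
  -- The tree property concerns a finite tuple `x`, so variables of `ι` that do not occur in `φ` are
  -- dropped.
  obtain ⟨m, g, ψ, hg, hψ⟩ : ∃ (m : ℕ) (g : Fin m → ι) (ψ : L.Formula (Fin m ⊕ Fin n)),
      Function.Injective g ∧ ∀ (e : ι → M) (c : Fin n → M),
        φ.Realize (Sum.elim e c) ↔ ψ.Realize (Sum.elim (e ∘ g) c) := by
    obtain ⟨m, g, ψ, hg, hψ⟩ := exists_realize_iff_comp (M := M) φ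
    let S : Finset ι := (Finset.univ.image g).toLeft
    have hS : ∀ i j, g i = Sum.inl j → j ∈ S := fun i j h => by simp [S, ← h]
    refine ⟨_, fun i => (S.equivFin.symm i : ι), ψ.relabel (fun i =>
      match h : g i with
      | Sum.inl j => Sum.inl (S.equivFin ⟨j, hS i j h⟩)
      | Sum.inr r => Sum.inr r), Subtype.val_injective.comp S.equivFin.symm.injective, fun e c => ?_⟩
    rw [hψ, Formula.realize_relabel]
    refine iff_of_eq (congrArg _ (funext fun i => ?_))
    simp only [Function.comp]
    split <;> simp [*]
  have hext : ∀ e : Fin m → M, ∃ e' : ι → M, e' ∘ g = e := fun e =>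
    ⟨Function.extend g e fun _ => Classical.arbitrary M, Function.extend_comp hg _ _⟩
  refine hT M m n k ψ ⟨fun s r => v (s, r), fun s t ht => ?_, fun f q hq hqf => ?_⟩
  · rintro ⟨e, he⟩
    obtain ⟨e, rfl⟩ := hext e
    refine hv (cK (s, t)) (Or.inl ⟨_, ht, rfl⟩) ⟨e, fun i hi => (hψ _ _).2 ?_⟩
    exact (sat_inst _ _ _).1 (he i hi)
  · have hq' : ∀ θ ∈ q, ∃ l : ℕ, inst ψ (fun r => v ((List.range (l + 1)).map f, r)) = θ :=
      fun θ hθ => hq hθ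
    choose! l hl using hq'
    obtain ⟨N, hN⟩ := (hqf.image l).bddAbove
    obtain ⟨e, he⟩ := hv (cP ((List.range (N + 1)).map f)) (Or.inr ⟨_, rfl⟩)
    refine ⟨e ∘ g, fun θ hθ => ?_⟩
    have hle : l θ ≤ N := hN ⟨θ, hθ, rfl⟩
    rw [← hl θ hθ, sat_inst, ← hψ]
    have := he (l θ) (by simp; omega)
    rw [← List.map_take, List.take_range, min_eq_left (by omega)] at this
    exact this

end Split

/-! ### Dividing and forking through automorphisms -/

section Dividing

variable {L : FirstOrder.Language.{u, v}} {M : Type w} [L.Structure M] {ι D : Type*}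
  {A B C : Set M} {k : ℕ} {X : Set (ι → M)}

variable (L) in
/-- The set `X` divides over `A` with respect to `k`: there are infinitely many conjugates of `X`
over `A`, any `k` of which have empty intersection. -/
def SDiv (A : Set M) (k : ℕ) (X : Set (ι → M)) : Prop :=
  ∃ σ : ℕ → (M ≃[L] M), (∀ i, Fixes A (σ i)) ∧
    ∀ s : Finset ℕ, s.card = k → ¬ ∃ e : ι → M, ∀ i ∈ s, σ i ∘ e ∈ X

variable (L) in
/-- The type of `d` over `C` does not divide over `A`. -/
def NonDividing (A C : Set M) (d : D → M) : Prop :=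
  ∀ X, IsDef L C X → d ∈ X → ∀ k, ¬ SDiv L A k X

variable (L) in
/-- The type of `d` over `C` does not fork over `A`. -/
def NonForking (A C : Set M) (d : D → M) : Prop :=
  ∀ (m : ℕ) (Y : Fin m → Set (D → M)), (∀ j, IsDef L Set.univ (Y j)) →
    (∀ j, ∃ k, SDiv L A k (Y j)) → ∀ X, IsDef L C X → d ∈ X → ¬ X ⊆ ⋃ j, Y j

theorem SDiv.mono (h : SDiv L B k X) (hAB : A ⊆ B) : SDiv L A k X := by
  obtain ⟨σ, hσ, h⟩ := h
  exact ⟨σ, fun i => (hσ i).mono hAB, h⟩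

theorem comp_symm_comp (σ : M ≃[L] M) (e : ι → M) : σ ∘ σ.symm ∘ e = e := by
  ext a; simp

theorem symm_comp_comp (σ : M ≃[L] M) (e : ι → M) : σ.symm ∘ σ ∘ e = e := by
  ext a; simp

theorem comp_comp_eq (σ τ : M ≃[L] M) (e : ι → M) : (σ.comp τ) ∘ e = σ ∘ τ ∘ e := by
  ext a; simp

theorem SDiv.preimage (h : SDiv L A k X) {τ : M ≃[L] M} (hτ : Fixes A τ) :
    SDiv L A k {e : ι → M | τ ∘ e ∈ X} := by
  obtain ⟨σ, hσ, h⟩ := h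
  refine ⟨fun i => τ.symm.comp (σ i), fun i => hτ.symm.comp (hσ i), fun s hs ⟨e, he⟩ => ?_⟩
  refine h s hs ⟨e, fun i hi => ?_⟩
  have := he i hi
  rwa [Set.mem_ofPred_eq, comp_comp_eq, comp_symm_comp] at this

theorem NonDividing.base_mono {d : D → M} (h : NonDividing L A C d) (hAB : A ⊆ B) :
    NonDividing L B C d :=
  fun X hX hd k hk => h X hX hd k (hk.mono hAB)

theorem NonDividing.of_comp {d : D → M} {τ : M ≃[L] M} (h : NonDividing L A C (τ ∘ d))
    (hτ : Fixes A τ) (hBC : ∀ b ∈ B, τ b ∈ C) : NonDividing L A B d := by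
  intro X hX hd k hk
  refine h _ (hX.image τ hBC) ?_ k (hk.preimage hτ.symm)
  rwa [Set.mem_ofPred_eq, symm_comp_comp]

theorem SDiv.divides {n : ℕ} {φ : L.Formula (ι ⊕ Fin n)} {c : Fin n → M}
    (h : SDiv L A k {e | φ.Realize (Sum.elim e c)}) : Divides A φ c := by
  obtain ⟨σ, hσ, h⟩ := h
  refine ⟨k, fun i => (σ i).symm ∘ c, fun i => ?_, fun s hs ⟨e, he⟩ => ?_⟩
  · exact (tp_eq_iff.2 (tpEq_comp_of_fixes (hσ i).symm c)).symm
  · refine h s hs ⟨e, fun i hi => ?_⟩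
    have := he i hi
    rwa [sat_inst, ← realize_elim_comp] at this

theorem sDiv_of_kInconsistent {T : L.Theory} {κ : Cardinal.{w}} (hM : IsMonster T M κ)
    (hA : IsSmall κ A) {n : ℕ} {φ : L.Formula (ι ⊕ Fin n)} {c : Fin n → M} {d : ℕ → Fin n → M}
    (hd : ∀ i, TpEq L A c (d i)) (h : KInconsistent k φ d) :
    SDiv L A k {e | φ.Realize (Sum.elim e c)} := by
  choose σ hσ hσd using fun i => hM.exists_fixes_of_tpEq hA
    (isSmall_of_countable hM.aleph0_lt) (hd i)
  refine ⟨fun i => (σ i).symm, fun i => (hσ i).symm, fun s hs ⟨e, he⟩ => ?_⟩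
  refine h s hs ⟨e, fun i hi => ?_⟩
  have := he i hi
  rw [Set.mem_ofPred_eq, realize_elim_comp] at this
  rw [sat_inst, ← hσd i]
  exact this

theorem nonForking_of_indep {ι ι' : Type x} {a : ι → M} {b : ι' → M} (h : Indep L A a b) :
    NonForking L A (A ∪ Set.range b) a := by
  intro m Y hY hdiv X hX ha hsub
  choose n φ c _ hφ using fun j => (hY j).exists_finite
  obtain ⟨θ, hθ, hXθ⟩ := hX.exists_isOver
  refine h ⟨m, n, φ, c, fun j => ?_, {θ}, ?_, Set.finite_singleton θ, fun e he => ?_⟩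
  · obtain ⟨k, hk⟩ := hdiv j
    refine SDiv.divides (k := k) ?_
    rwa [show {e | (φ j).Realize (Sum.elim e (c j))} = Y j from Set.ext fun e => (hφ j e).symm]
  · rintro _ rfl
    exact ⟨hθ, (hXθ a).1 ha⟩
  · obtain ⟨j, hj⟩ := Set.mem_iUnion.1 (hsub ((hXθ e).2 (he θ rfl)))
    exact ⟨j, (sat_inst _ _ _).2 ((hφ j e).1 hj)⟩

theorem preimage_mem_splitFam {P : Σ n, L.Formula (ι ⊕ Fin n)} {c : Fin P.1 → M}
    {σ : ℕ → (M ≃[L] M)}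
    (h : ∀ s : Finset ℕ, s.card = k →
      ¬ ∃ e : ι → M, ∀ i ∈ s, σ i ∘ e ∈ {e | P.2.Realize (Sum.elim e c)}) :
    (fun i => tupleEquiv (σ i) ⁻¹' {e : ι → M | P.2.Realize (Sum.elim e c)}) ∈ splitFam M P k := by
  refine ⟨fun i => (σ i).symm ∘ c, fun s hs ⟨e, he⟩ => h s hs ⟨e, fun i hi => ?_⟩, fun i => ?_⟩
  · have := he i hi
    rwa [sat_inst, ← realize_elim_comp] at this
  · ext e
    exact realize_elim_comp _ _ _ _

variable {T : L.Theory} {κ : Cardinal.{w}}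

/-- If a set over `C` divides over `B` and the type of `d` over `C` does not divide over `B`, then
the set still divides over `B ∪ d`. -/
theorem SDiv.union_range (hM : IsMonster T M κ) (hC : IsSmall κ C) (hBC : B ⊆ C)
    (hD : IsSmall κ D) {d : D → M} (hd : NonDividing L B C d) (hX : IsDef L C X)
    (h : SDiv L B k X) : SDiv L (B ∪ Set.range d) k X := by
  classical
  have := hM.nonempty
  obtain ⟨φ, hφ⟩ := hX
  obtain ⟨σ, hσ, hσk⟩ := h
  -- The unknowns are copies `C_i` of `C` and one copy `d'` of `d`: `cE` forces `C_i d'` to have the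
  -- type of `C d` over `B`, and `cK` makes the corresponding copies of `X` `k`-inconsistent.
  let cK : Finset ℕ → Set ((ℕ × C) ⊕ D → M) := fun t =>
    {w | ¬ ∃ e : ι → M, ∀ i ∈ t, φ.Realize (Sum.elim e fun c => w (Sum.inl (i, c)))}
  let cE : ℕ × Set (C ⊕ D → M) → Set ((ℕ × C) ⊕ D → M) := fun p =>
    {w | w ∘ Sum.map (fun c => (p.1, c)) id ∈ p.2}
  obtain ⟨w, hw⟩ := hM.exists_mem_of_fip (hC.subset hBC)
    (V := (ℕ × C) ⊕ D) (((isSmall_of_countable hM.aleph0_lt).prod hM.aleph0_lt.le hC).sum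
      hM.aleph0_lt.le hD)
    (𝒳 := cK '' {t | t.card = k} ∪ cE '' {p | IsDef L B p.2 ∧ Sum.elim Subtype.val d ∈ p.2}) (by
      rintro _ (⟨t, -, rfl⟩ | ⟨p, hp, rfl⟩)
      · refine (IsDef.exists_left (IsDef.iInter_finset t (fun i => {w : ι ⊕ ((ℕ × C) ⊕ D) → M |
          φ.Realize (Sum.elim (w ∘ Sum.inl) fun c => w (Sum.inr (Sum.inl (i, c))))})
          fun i _ => ?_)).compl
        refine ((isDef_realize φ).preimage
          (Sum.map id fun c => (Sum.inl (i, c)))).congr fun w => ?_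
        refine iff_of_eq (congrArg φ.Realize ?_)
        ext (_ | _) <;> rfl
      · exact hp.1.preimage _) (by
      intro F hF
      have hb : ∀ Z ∈ F, ∃ (m : ℕ) (Y : Set (C ⊕ D → M)), (IsDef L B Y ∧
          Sum.elim Subtype.val d ∈ Y) ∧ ((∃ t : Finset ℕ, t.card = k ∧ (∀ i ∈ t, i < m) ∧
            Z = cK t) ∨ ∃ i < m, Z = cE (i, Y)) := by
        intro Z hZ
        rcases hF hZ with ⟨t, ht, rfl⟩ | ⟨p, hp, rfl⟩
        · exact ⟨t.sup id + 1, Set.univ, ⟨isDef_univ, trivial⟩, Or.inl ⟨t, ht,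
            fun i hi => Nat.lt_succ_of_le (Finset.le_sup (f := id) hi), rfl⟩⟩
        · exact ⟨p.1 + 1, p.2, hp, Or.inr ⟨p.1, Nat.lt_succ_self _, rfl⟩⟩
      choose! m Y hY hZ using hb
      let Y₀ : Set (C ⊕ D → M) := {e | ∀ Z ∈ F, e ∈ Y Z}
      have hY₀ : IsDef L B Y₀ := IsDef.iInter_finset F Y fun Z hZ => (hY Z hZ).1
      have hQ : IsDef L C {z : D → M | Sum.elim Subtype.val z ∈ Y₀} := by
        refine (((hY₀.mono hBC).preimage (Sum.swap : C ⊕ D → D ⊕ C)).subst Subtype.val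
          fun i => i.2).congr fun z => ?_
        have hz : Sum.elim z Subtype.val ∘ Sum.swap = Sum.elim (Subtype.val : C → M) z := by
          ext (_ | _) <;> rfl
        change _ ↔ Sum.elim z Subtype.val ∘ Sum.swap ∈ Y₀
        rw [hz]; rfl
      -- As `Q` does not divide over `B`, arbitrarily many of its given conjugates share a point
      -- `z`, which serves as `d'`; `g` enumerates their indices.
      have hnot := hd _ hQ (fun Z hZ => (hY Z hZ).2) (F.sup m)
      simp only [SDiv, not_exists, not_and, not_forall, not_not] at hnot
      obtain ⟨s, hs, z, hz⟩ := hnot σ hσ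
      let g : ℕ → ℕ := fun i => if h : i < F.sup m then s.orderEmbOfFin hs ⟨i, h⟩ else 0
      have hgs : ∀ i < F.sup m, g i ∈ s := fun i hi => by
        simp only [g, hi, dif_pos]
        exact Finset.orderEmbOfFin_mem s hs _
      have hginj : ∀ i < F.sup m, ∀ j < F.sup m, g i = g j → i = j := fun i hi j hj hij => by
        simp only [g, hi, hj, dif_pos] at hij
        simpa using (s.orderEmbOfFin hs).injective hij
      refine ⟨Sum.elim (fun p => (σ (g p.1)).symm p.2) z, fun Z hZF => ?_⟩
      have hle := Finset.le_sup (f := m) hZF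
      rcases hZ Z hZF with ⟨t, ht, htm, hZt⟩ | ⟨i, him, hZi⟩
      · rw [hZt]
        rintro ⟨e, he⟩
        refine hσk (t.image g) ?_ ⟨e, fun i' hi' => ?_⟩
        · rw [Finset.card_image_of_injOn, ht]
          intro i hi j hj hij
          exact hginj i ((htm i hi).trans_le hle) j ((htm j hj).trans_le hle) hij
        · obtain ⟨i, hi, rfl⟩ := Finset.mem_image.1 hi'
          rw [hφ, realize_elim_comp]
          exact he i hi
      · rw [hZi]
        have h1 := hz (g i) (hgs i (him.trans_le hle)) Z hZF
        have h2 := ((hY Z hZF).1.mem_iff_of_fixes (hσ (g i)).symm _).2 h1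
        rw [Sum.comp_elim, symm_comp_comp] at h2
        change _ ∈ Y Z
        convert h2 using 1
        ext (_ | _) <;> rfl)
  have htp : ∀ i, TpEq L B (Sum.elim Subtype.val d)
      (w ∘ Sum.map (fun c : C => (i, c)) (id : D → D)) := fun i Y hY hmem =>
    hw (cE (i, Y)) (Or.inr ⟨_, ⟨hY, hmem⟩, rfl⟩)
  choose τ hτ hτw using fun i => hM.exists_fixes_of_tpEq (hC.subset hBC)
    ((hC.sum hM.aleph0_lt.le hD).range _) (htp i)
  have hτc : ∀ i, τ i ∘ (Subtype.val : C → M) = fun c => w (Sum.inl (i, c)) := fun i =>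
    funext fun c => congrFun (hτw i) (Sum.inl c)
  have hτd : ∀ i v, τ i (d v) = w (Sum.inr v) := fun i v => congrFun (hτw i) (Sum.inr v)
  -- All `τ i` send `d` to the same `d'`, so these composites fix `d`.
  refine ⟨fun i => (τ i).symm.comp (τ 0), fun i => ?_, fun s hs ⟨e, he⟩ => ?_⟩
  · rintro _ (hb | ⟨v, rfl⟩)
    · exact (hτ i).symm.comp (hτ 0) _ hb
    · rw [Equiv.comp_apply, hτd, ← hτd i]
      exact (τ i).symm_apply_apply _
  · refine hw (cK s) (Or.inl ⟨s, hs, rfl⟩) ⟨τ 0 ∘ e, fun i hi => ?_⟩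
    have := he i hi
    rw [comp_comp_eq, hφ, realize_elim_comp] at this
    rw [← hτc]
    exact this

/-- Extension: by compactness, a failure would put a set in the type of `a` over `C` inside finitely
many sets that divide over `A`. -/
theorem NonForking.exists_fixes (hM : IsMonster T M κ) {a : D → M} (h : NonForking L A C a)
    (hC : IsSmall κ C) (hB : IsSmall κ B) (hD : IsSmall κ D) :
    ∃ τ : M ≃[L] M, Fixes C τ ∧ NonDividing L A B (τ ∘ a) := by
  classical
  let 𝒴 : Set (Set (D → M)) := {Y | IsDef L B Y ∧ ∃ k, SDiv L A k Y}
  obtain ⟨e, he⟩ := hM.exists_mem_of_fip (hC.union hM.aleph0_lt.le hB) hD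
    (𝒳 := {X | IsDef L C X ∧ a ∈ X} ∪ {X | Xᶜ ∈ 𝒴}) (by
      rintro X (hX | hX)
      · exact hX.1.mono Set.subset_union_left
      · rw [← compl_compl X]
        exact hX.1.compl.mono Set.subset_union_right) (by
      intro F hF
      by_contra! hcon
      let F₁ := F.filter fun X => IsDef L C X ∧ a ∈ X
      let F₂ := F.filter fun X => Xᶜ ∈ 𝒴
      have hF₂ : ∀ j, ((F₂.equivFin.symm j : Set (D → M)))ᶜ ∈ 𝒴 := fun j =>
        (Finset.mem_filter.1 (F₂.equivFin.symm j).2).2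
      refine h _ (fun j => ((F₂.equivFin.symm j : Set (D → M)))ᶜ)
        (fun j => (hF₂ j).1.mono (Set.subset_univ _)) (fun j => (hF₂ j).2)
        {e | ∀ X ∈ F₁, e ∈ X}
        (IsDef.iInter_finset F₁ id fun X hX => (Finset.mem_filter.1 hX).2.1)
        (fun X hX => (Finset.mem_filter.1 hX).2.2) fun e he => ?_
      obtain ⟨X, hX, heX⟩ := hcon e
      rcases hF hX with h1 | h2
      · exact absurd (he X (Finset.mem_filter.2 ⟨hX, h1⟩)) heX
      · refine Set.mem_iUnion.2 ⟨F₂.equivFin ⟨X, Finset.mem_filter.2 ⟨hX, h2⟩⟩, ?_⟩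
        simpa using heX)
  obtain ⟨τ, hτ, rfl⟩ := hM.exists_fixes_of_tpEq hC (hD.range a)
    (fun X hX ha => he X (Or.inl ⟨hX, ha⟩))
  refine ⟨τ, hτ, fun X hX ha k hk => ?_⟩
  exact he Xᶜ (Or.inr (show Xᶜᶜ ∈ 𝒴 from (compl_compl X).symm ▸ ⟨hX, k, hk⟩)) ha

/-- In a simple theory, a type does not fork over its domain. -/
theorem nonForking_self (hM : IsMonster T M κ) (hT : IsSimple.{u, v, w} T) (a : D → M) :
    NonForking L A A a := by
  intro m Y hY hdiv X hX ha hsub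
  choose n φ c _ hφ using fun j => (hY j).exists_finite
  choose k hk using hdiv
  have hYeq : ∀ j, Y j = {e | (φ j).Realize (Sum.elim e (c j))} := fun j => Set.ext (hφ j)
  have : Nonempty (Fin m) := by
    obtain ⟨j, -⟩ := Set.mem_iUnion.1 (hsub ha)
    exact ⟨j⟩
  let G : Fin m → Set (ℕ → Set (D → M)) := fun j => splitFam M ⟨n j, φ j⟩ (k j)
  choose N hN using fun j => exists_not_splitRank hM hT ⟨n j, φ j⟩ (k j)
  have hG : ReindexClosed (⋃ j, G j) := fun Z hZ g hg => by
    obtain ⟨j, hj⟩ := Set.mem_iUnion.1 hZ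
    exact Set.mem_iUnion.2 ⟨j, reindexClosed_splitFam _ _ Z hj g hg⟩
  -- If `X` has rank `r`, so does some `X ∩ Y j`. The dividing automorphisms preserve `X`, so the
  -- conjugates of `Y j` split `X` into pieces of rank `r`, and `X` has rank `r + 1`.
  have hall : ∀ r, SplitRank (⋃ j, G j) r X := by
    intro r
    induction r with
    | zero => exact ⟨a, ha⟩
    | succ r ih =>
      obtain ⟨j, hj⟩ := ih.exists_inter hG Y hsub
      obtain ⟨σ, hσ, hσk⟩ := hk j
      refine ⟨fun i => tupleEquiv (σ i) ⁻¹' (Y j), Set.mem_iUnion.2 ⟨j, ?_⟩, fun i => ?_⟩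
      · rw [hYeq] at hσk ⊢
        exact preimage_mem_splitFam (P := ⟨n j, φ j⟩) hσk
      · refine (hj.preimage (tupleEquiv (σ i)) fun Z hZ => ?_).mono ?_
        · obtain ⟨j, hj⟩ := Set.mem_iUnion.1 hZ
          exact Set.mem_iUnion.2 ⟨j, splitFam_preimage _ _ _ Z hj⟩
        · exact fun e he => ⟨(hX.mem_iff_of_fixes (hσ i) e).1 he.1, he.2⟩
  obtain ⟨j, hj⟩ := SplitRank.exists_of_iUnion (fun j => reindexClosed_splitFam _ _) N (hall _)
  exact hN j (hj.mono (Set.subset_univ _))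

/-- Iterated extension gives conjugates of `a` over `C`, each independent over `A` from all earlier
ones; it replaces a Morley sequence. -/
theorem NonForking.exists_seq (hM : IsMonster T M κ) {a : D → M} (h : NonForking L A C a)
    (hC : IsSmall κ C) (hD : IsSmall κ D) :
    ∃ (τ : ℕ → (M ≃[L] M)) (S : ℕ → Set M), (∀ i, Fixes C (τ i)) ∧ (∀ i, IsSmall κ (S i)) ∧
      (∀ i, C ⊆ S i) ∧ Monotone S ∧ (∀ i, Set.range (τ i ∘ a) ⊆ S (i + 1)) ∧
      ∀ i, NonDividing L A (S i) (τ i ∘ a) := by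
  choose! pick hp hp' using fun (B : Set M) (hB : IsSmall κ B) => h.exists_fixes hM hC hB hD
  let S : ℕ → Set M := fun i => Nat.rec (motive := fun _ => Set M) C
    (fun _ S => S ∪ Set.range (pick S ∘ a)) i
  have hS : ∀ i, S (i + 1) = S i ∪ Set.range (pick (S i) ∘ a) := fun i => rfl
  have hsmall : ∀ i, IsSmall κ (S i) := fun i => by
    induction i with
    | zero => exact hC
    | succ i ih => exact ih.union hM.aleph0_lt.le (hD.range _)
  have hmono : Monotone S := monotone_nat_of_le_succ fun i => by
    rw [hS]; exact Set.subset_union_left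
  refine ⟨fun i => pick (S i), S, fun i => hp _ (hsmall i), hsmall, fun i => hmono (Nat.zero_le i),
    hmono, fun i => ?_, fun i => hp' _ (hsmall i)⟩
  rw [hS]; exact Set.subset_union_right

/-- A set that divides over `A` is inconsistent along every sufficiently long independent
sequence. -/
theorem not_exists_mem_of_indep_seq (hM : IsMonster T M κ) {a : D → M} (hD : IsSmall κ D)
    {P : Σ n, L.Formula (ι ⊕ Fin n)} {c : Fin P.1 → M} {N : ℕ}
    (hN : ¬ SplitRank (splitFam M P k) N Set.univ)
    (hc : IsDef L (A ∪ Set.range a) {e : ι → M | P.2.Realize (Sum.elim e c)})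
    (hdiv : SDiv L A k {e : ι → M | P.2.Realize (Sum.elim e c)})
    {τ : ℕ → (M ≃[L] M)} {S : ℕ → Set M} (hτ : ∀ i, Fixes A (τ i)) (hS : ∀ i, IsSmall κ (S i))
    (hAS : ∀ i, A ⊆ S i) (hmono : Monotone S) (hrange : ∀ i, Set.range (τ i ∘ a) ⊆ S (i + 1))
    (hnd : ∀ i, NonDividing L A (S i) (τ i ∘ a)) (s : Finset ℕ) (hs : s.card = N) :
    ¬ ∃ e : ι → M, ∀ i ∈ s, (τ i).symm ∘ e ∈ {e : ι → M | P.2.Realize (Sum.elim e c)} := by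
  classical
  let X : ℕ → Set (ι → M) := fun i => {e | P.2.Realize (Sum.elim e (τ i ∘ c))}
  have hXeq : ∀ i, {e | (τ i).symm ∘ e ∈ {e : ι → M | P.2.Realize (Sum.elim e c)}} = X i :=
    fun i => Set.ext fun e => realize_elim_comp _ (τ i).symm _ _
  have hXdef' : ∀ i, IsDef L (A ∪ Set.range (τ i ∘ a)) (X i) := fun i => by
    rw [← hXeq]
    refine hc.image (τ i) ?_
    rintro _ (hb | ⟨v, rfl⟩)
    · rw [hτ i _ hb]; exact Or.inl hb
    · exact Or.inr ⟨v, rfl⟩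
  have hXdef : ∀ i, IsDef L (S (i + 1)) (X i) := fun i =>
    (hXdef' i).mono (Set.union_subset (hAS _) (hrange i))
  have hXdiv : ∀ i, SDiv L A k (X i) := fun i => by
    rw [← hXeq]; exact hdiv.preimage (hτ i).symm
  let U : Finset ℕ → Set M := fun t => ⋃ q ∈ t, Set.range (τ q ∘ a)
  have hU : ∀ q t, U (insert q t) = U t ∪ Set.range (τ q ∘ a) := fun q t => by
    simp only [U, Finset.set_biUnion_insert, Set.union_comm]
  -- Dividing of `X i` survives adding later members of the sequence to the base, one at a time in
  -- increasing order, by `SDiv.union_range`.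
  have hstep : ∀ i (t : Finset ℕ), (∀ q ∈ t, i < q) → SDiv L (A ∪ U t) k (X i) := by
    intro i t
    induction t using Finset.induction_on_max with
    | empty => intro _; simpa [U] using hXdiv i
    | insert q t hq ih =>
      intro hi
      have hsub : A ∪ U t ⊆ S q := by
        refine Set.union_subset (hAS q) (Set.iUnion₂_subset fun r hr => ?_)
        exact (hrange r).trans (hmono (hq r hr))
      have := (ih fun r hr => hi r (Finset.mem_insert_of_mem hr)).union_range hM (hS q) hsub hD
        ((hnd q).base_mono Set.subset_union_left)
        ((hXdef i).mono (hmono (hi q (Finset.mem_insert_self q t))))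
      rwa [hU, ← Set.union_assoc]
  -- The sequence is read backwards: the set with the largest index splits first, and its parameters
  -- enter the base. The remaining sets still divide over this base by `hstep`, so a common point
  -- yields one unit of rank per index.
  have hrank : ∀ (t : Finset ℕ) (B : Set M) (Y : Set (ι → M)), A ⊆ B →
      (∀ i ∈ t, SDiv L (B ∪ U (t.filter (i < ·))) k (X i)) →
      (∀ σ : M ≃[L] M, Fixes B σ → ∀ e ∈ Y, σ.symm ∘ e ∈ Y) →
      (∃ e ∈ Y, ∀ i ∈ t, e ∈ X i) → SplitRank (splitFam M P k) t.card Y := by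
    intro t
    induction t using Finset.induction_on_max with
    | empty => rintro B Y - - - ⟨e, he, -⟩; exact ⟨e, he⟩
    | insert q t hq ih =>
      rintro B Y hAB hX hY ⟨e, heY, he⟩
      have hqt : q ∉ t := fun h => lt_irrefl _ (hq q h)
      rw [Finset.card_insert_of_notMem hqt]
      have hr := ih (B ∪ Set.range (τ q ∘ a)) (Y ∩ X q)
        (hAB.trans Set.subset_union_left) (fun i hi => by
        have := hX i (Finset.mem_insert_of_mem hi)
        rw [Finset.filter_insert, if_pos (hq i hi), hU] at this
        rwa [Set.union_assoc, Set.union_comm (Set.range _)])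
        (fun σ hσ e he => ⟨hY σ (hσ.mono Set.subset_union_left) e he.1,
          ((hXdef' q).mem_iff_of_fixes
            (hσ.mono (Set.union_subset_union_left _ hAB)).symm e).2 he.2⟩)
        ⟨e, ⟨heY, he q (Finset.mem_insert_self q t)⟩,
          fun i hi => he i (Finset.mem_insert_of_mem hi)⟩
      obtain ⟨σ, hσ, hσk⟩ := (hX q (Finset.mem_insert_self q t)).mono Set.subset_union_left
      refine ⟨_, preimage_mem_splitFam hσk, fun i => ?_⟩
      refine (hr.preimage (tupleEquiv (σ i)) (splitFam_preimage _ _ _)).mono fun e he => ?_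
      refine ⟨?_, he.2⟩
      have := hY (σ i) (hσ i) _ he.1
      rwa [tupleEquiv_apply, symm_comp_comp] at this
  rintro ⟨e, he⟩
  refine hN (hs ▸ hrank s A Set.univ subset_rfl (fun i _ => hstep i _ fun q hq => (Finset.mem_filter.1 hq).2)
    (fun _ _ _ _ => trivial) ⟨e, trivial, fun i hi => ?_⟩)
  rw [← hXeq]
  exact he i hi

end Dividing

/-! ### Symmetry, and forking equals dividing -/

section Simple

variable {L : FirstOrder.Language.{u, v}} {M : Type w} [L.Structure M] {D D' : Type*}
  {A B C : Set M} {T : L.Theory} {κ : Cardinal.{w}}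

/-- Take an independent sequence of conjugates of `a` over `A ∪ c`. A set over `A ∪ a` that contains
`c` has all its conjugates through `c`, so it cannot divide over `A`. -/
theorem NonForking.symm (hM : IsMonster T M κ) (hT : IsSimple.{u, v, w} T) (hA : IsSmall κ A)
    (hD : IsSmall κ D) (hD' : IsSmall κ D') {a : D → M} {c : D' → M}
    (h : NonForking L A (A ∪ Set.range c) a) : NonDividing L A (A ∪ Set.range a) c := by
  intro X hX hc k hk
  obtain ⟨n, φ, p, -, hφ⟩ := hX.exists_finite
  obtain rfl : X = {e | φ.Realize (Sum.elim e p)} := Set.ext hφ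
  obtain ⟨N, hN⟩ := exists_not_splitRank hM hT ⟨n, φ⟩ k
  obtain ⟨τ, S, hτ, hS, hCS, hmono, hrange, hnd⟩ :=
    h.exists_seq hM (hA.union hM.aleph0_lt.le (hD'.range c)) hD
  refine not_exists_mem_of_indep_seq hM hD (P := ⟨n, φ⟩) hN hX hk
    (fun i => (hτ i).mono Set.subset_union_left) hS
    (fun i => Set.subset_union_left.trans (hCS i)) hmono hrange hnd (Finset.range N) (by simp)
    ⟨c, fun i _ => ?_⟩
  rwa [show (τ i).symm ∘ c = c from
    funext fun v => (hτ i).symm (c v) (Or.inr ⟨v, rfl⟩)]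

/-- Let `p` collect the parameters of a dividing cover of `X`, and conjugate along an independent
sequence for `p`. Since `X` does not divide, `∑ j, N j` conjugates share a point. By pigeonhole, `N
j` of the corresponding conjugates of one `Y j` contain it, which the rank bound forbids. -/
theorem NonDividing.nonForking (hM : IsMonster T M κ) (hT : IsSimple.{u, v, w} T)
    (hA : IsSmall κ A) {a : D → M} (h : NonDividing L A C a) : NonForking L A C a := by
  classical
  intro m Y hY hdiv X hX ha hsub
  choose n φ c _ hφ using fun j => (hY j).exists_finite
  choose k hk using hdiv
  obtain rfl : Y = fun j => {e | (φ j).Realize (Sum.elim e (c j))} :=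
    funext fun j => Set.ext (hφ j)
  have : Nonempty (Fin m) := by
    obtain ⟨j, -⟩ := Set.mem_iUnion.1 (hsub ha)
    exact ⟨j⟩
  choose N hN using fun j => exists_not_splitRank hM hT ⟨n j, φ j⟩ (k j)
  let p : (Σ j, Fin (n j)) → M := fun q => c q.1 q.2
  obtain ⟨τ, S, hτ, hS, hCS, hmono, hrange, hnd⟩ :=
    (nonForking_self (A := A) hM hT p).exists_seq hM hA (isSmall_of_countable hM.aleph0_lt)
  refine h X hX ha (∑ j, N j) ⟨fun i => (τ i).symm, fun i => (hτ i).symm, fun s hs ⟨e, he⟩ => ?_⟩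
  have hcov : ∀ i, i ∈ s → ∃ j, (φ j).Realize (Sum.elim ((τ i).symm ∘ e) (c j)) := fun i hi => by
    obtain ⟨j, hj⟩ := Set.mem_iUnion.1 (hsub (he i hi))
    exact ⟨j, hj⟩
  choose! f hf using hcov
  rw [Finset.card_eq_sum_card_fiberwise (f := f) (t := Finset.univ) (by simp)] at hs
  obtain ⟨j, -, hj⟩ := Finset.exists_le_of_sum_le Finset.univ_nonempty hs.ge
  obtain ⟨s', hs', hcard⟩ := Finset.exists_subset_card_eq hj
  refine not_exists_mem_of_indep_seq hM (isSmall_of_countable hM.aleph0_lt) (P := ⟨n j, φ j⟩)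
    (hN j) (isDef_realize_param _ _ fun i => Or.inr ⟨⟨j, i⟩, rfl⟩) (hk j) hτ hS hCS hmono hrange
    hnd s' hcard ⟨e, fun i hi => ?_⟩
  obtain ⟨hi, rfl⟩ := Finset.mem_filter.1 (hs' hi)
  exact hf i hi

end Simple

/-! ### Natural sums and shuffles of ordinals -/

section Ordinals

open Ordinal

theorem natSum_le_iff {α β γ : Ordinal.{t}} : natSum α β ≤ γ ↔
    (∀ α' < α, natSum α' β < γ) ∧ ∀ β' < β, natSum α β' < γ := by
  rw [natSum, max_le_iff, Ordinal.iSup_le_iff, Ordinal.iSup_le_iff]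
  simp

theorem natSum_lt_left {α α' : Ordinal.{t}} (β : Ordinal.{t}) (h : α' < α) :
    natSum α' β < natSum α β := (natSum_le_iff.1 le_rfl).1 α' h

theorem natSum_lt_right {β β' : Ordinal.{t}} (α : Ordinal.{t}) (h : β' < β) :
    natSum α β' < natSum α β := (natSum_le_iff.1 le_rfl).2 β' h

theorem exists_eq_opow_mul_add {x γ : Ordinal.{t}} {m : ℕ} (h : x < ω ^ γ * m) :
    ∃ (r : ℕ) (y : Ordinal.{t}), y < ω ^ γ ∧ x = ω ^ γ * r + y ∧ r < m := by
  have hpos : ω ^ γ ≠ 0 := (opow_pos γ omega0_pos).ne'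
  have h1 : x / ω ^ γ < m := (Ordinal.lt_mul_iff_div_lt hpos).1 h
  obtain ⟨r, hr⟩ := lt_omega0.1 (h1.trans (natCast_lt_omega0 m))
  refine ⟨r, x % ω ^ γ, mod_lt x hpos, ?_, ?_⟩
  · rw [← hr, div_add_mod]
  · rw [hr] at h1; exact_mod_cast h1

/-- An ordinal below `ω ^ γ * m + x` has either a smaller coefficient, in which case `hγ` absorbs
the remainder, or the same coefficient and a smaller remainder. The upper bound suffices, as
shuffles can be truncated. -/
theorem natSum_le_opow_mul_add {γ : Ordinal.{t}}
    (hγ : ∀ x < ω ^ γ, ∀ y < ω ^ γ, natSum x y < ω ^ γ) (α β : Ordinal.{t}) (m n : ℕ)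
    (x y : Ordinal.{t}) (hx : x < ω ^ γ) (hy : y < ω ^ γ) (hα : α = ω ^ γ * m + x)
    (hβ : β = ω ^ γ * n + y) : natSum α β ≤ ω ^ γ * (m + n : ℕ) + natSum x y := by
  induction α using WellFoundedLT.induction generalizing β m n x y with
  | ind α ihα =>
  induction β using WellFoundedLT.induction generalizing m n x y with
  | ind β ihβ =>
  have key : ∀ r s : ℕ, r < s → ∀ z < ω ^ γ, ω ^ γ * r + z < ω ^ γ * s := fun r s hrs z hz => by
    calc ω ^ γ * r + z < ω ^ γ * r + ω ^ γ := by gcongr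
      _ = ω ^ γ * (r + 1 : ℕ) := by push_cast; rw [mul_add, mul_one]
      _ ≤ ω ^ γ * s := by gcongr; exact_mod_cast hrs
  have hdec : ∀ z (m : ℕ) x, x < ω ^ γ → z < ω ^ γ * m + x →
      ∃ (r : ℕ) (z' : Ordinal.{t}), z' < ω ^ γ ∧ z = ω ^ γ * r + z' ∧
        (r < m ∨ r = m ∧ z' < x) := by
    intro z m x hx hz
    by_cases h : z < ω ^ γ * m
    · obtain ⟨r, z', h1, h2, h3⟩ := exists_eq_opow_mul_add h
      exact ⟨r, z', h1, h2, Or.inl h3⟩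
    · obtain ⟨z', rfl⟩ := exists_add_of_le (not_lt.1 h)
      have : z' < x := by simpa using hz
      exact ⟨m, z', this.trans hx, rfl, Or.inr ⟨rfl, this⟩⟩
  rw [natSum_le_iff]
  constructor
  · intro α' hα'
    obtain ⟨r, z, hz, hαz, hrm⟩ := hdec α' m x hx (hα ▸ hα')
    refine (ihα α' hα' β r n z y hz hy hαz hβ).trans_lt ?_
    rcases hrm with hrm | ⟨rfl, hzx⟩
    · exact (key _ (m + n) (by omega) _ (hγ z hz y hy)).trans_le le_self_add
    · gcongr; exact natSum_lt_left y hzx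
  · intro β' hβ'
    obtain ⟨r, z, hz, hβz, hrm⟩ := hdec β' n y hy (hβ ▸ hβ')
    refine (ihβ β' hβ' m r x z hx hz hα hβz).trans_lt ?_
    rcases hrm with hrm | ⟨rfl, hzx⟩
    · exact (key _ (m + n) (by omega) _ (hγ x hx z hz)).trans_le le_self_add
    · gcongr; exact natSum_lt_right x hzx

/-- `δ` is the leading exponent of the larger ordinal; the other one may receive coefficient `0`. -/
theorem exists_common_log (x y γ : Ordinal.{t}) (hx : x < ω ^ γ) (hy : y < ω ^ γ)
    (hxy : x ≠ 0 ∨ y ≠ 0) : ∃ δ < γ, ∃ m n : ℕ, ∃ x' < ω ^ δ, ∃ y' < ω ^ δ,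
      x = ω ^ δ * m + x' ∧ y = ω ^ δ * n + y' := by
  let δ := log ω (max x y)
  have hmax : max x y ≠ 0 := by
    rcases hxy with h | h
    · exact ((pos_iff_ne_zero.2 h).trans_le (le_max_left _ _)).ne'
    · exact ((pos_iff_ne_zero.2 h).trans_le (le_max_right _ _)).ne'
  have hpos : ω ^ δ ≠ 0 := (opow_pos δ omega0_pos).ne'
  have hlt : max x y < ω ^ δ * ω := by
    rw [← opow_succ]; exact lt_opow_succ_log_self one_lt_omega0 _
  have hle : ω ^ δ ≤ max x y := opow_log_le_self ω hmax
  obtain ⟨m, hm⟩ := lt_omega0.1 ((Ordinal.lt_mul_iff_div_lt hpos).1 ((le_max_left x y).trans_lt hlt))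
  obtain ⟨n, hn⟩ := lt_omega0.1 ((Ordinal.lt_mul_iff_div_lt hpos).1 ((le_max_right x y).trans_lt hlt))
  refine ⟨δ, ?_, m, n, x % ω ^ δ, mod_lt _ hpos, y % ω ^ δ, mod_lt _ hpos, ?_, ?_⟩
  · exact (opow_lt_opow_iff_right one_lt_omega0).1 (hle.trans_lt (max_lt hx hy))
  · rw [← hm, div_add_mod]
  · rw [← hn, div_add_mod]

theorem natSum_lt_opow (γ : Ordinal.{t}) : ∀ x < ω ^ γ, ∀ y < ω ^ γ, natSum x y < ω ^ γ := by
  induction γ using WellFoundedLT.induction with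
  | ind γ ih =>
  intro x hx y hy
  by_cases hxy : x ≠ 0 ∨ y ≠ 0
  · obtain ⟨δ, hδ, m, n, x', hx', y', hy', rfl, rfl⟩ := exists_common_log x y γ hx hy hxy
    refine (natSum_le_opow_mul_add (ih δ hδ) _ _ m n x' y' hx' hy' rfl rfl).trans_lt ?_
    calc ω ^ δ * (m + n : ℕ) + natSum x' y' < ω ^ δ * (m + n : ℕ) + ω ^ δ := by
          gcongr; exact ih δ hδ x' hx' y' hy'
      _ = ω ^ δ * (m + n + 1 : ℕ) := by push_cast; simp only [mul_add, mul_one]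
      _ ≤ ω ^ δ * ω := by gcongr; exact (natCast_lt_omega0 _).le
      _ = ω ^ (Order.succ δ) := (opow_succ _ _).symm
      _ ≤ ω ^ γ := opow_le_opow_right omega0_pos (Order.succ_le_of_lt hδ)
  · push Not at hxy
    obtain ⟨rfl, rfl⟩ := hxy
    refine lt_of_le_of_lt (natSum_le_iff.2 ⟨?_, ?_⟩) hx <;> simp

/-- `f` shuffles `α` and `β` into a sequence of length `θ`: it is strictly increasing on the part
that it sends to `α` and on the part that it sends to `β`. -/
structure IsShuffle (α β θ : Ordinal.{t}) (f : Ordinal.{t} → Ordinal.{t} ⊕ Ordinal.{t}) : Prop where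
  left_lt : ∀ i < θ, ∀ p, f i = Sum.inl p → p < α
  right_lt : ∀ i < θ, ∀ p, f i = Sum.inr p → p < β
  left_mono : ∀ i j, i < j → j < θ → ∀ p q, f i = Sum.inl p → f j = Sum.inl q → p < q
  right_mono : ∀ i j, i < j → j < θ → ∀ p q, f i = Sum.inr p → f j = Sum.inr q → p < q

theorem isShuffle_inl (α : Ordinal.{t}) : IsShuffle α 0 α Sum.inl := by
  constructor <;> simp_all

theorem isShuffle_inr (α : Ordinal.{t}) : IsShuffle 0 α α Sum.inr := by
  constructor <;> simp_all

theorem IsShuffle.mono {α β θ θ' : Ordinal.{t}} {f} (h : IsShuffle α β θ f) (hθ : θ' ≤ θ) :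
    IsShuffle α β θ' f where
  left_lt i hi := h.left_lt i (hi.trans_le hθ)
  right_lt i hi := h.right_lt i (hi.trans_le hθ)
  left_mono i j hij hj := h.left_mono i j hij (hj.trans_le hθ)
  right_mono i j hij hj := h.right_mono i j hij (hj.trans_le hθ)

theorem IsShuffle.append {α β θ α' β' θ' : Ordinal.{t}} {f f'} (h : IsShuffle α β θ f)
    (h' : IsShuffle α' β' θ' f') : ∃ g, IsShuffle (α + α') (β + β') (θ + θ') g := by
  classical
  have hsub : ∀ i, ¬ i < θ → i < θ + θ' → i - θ < θ' := fun i hi hi' => by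
    obtain ⟨j, rfl⟩ := exists_add_of_le (not_lt.1 hi)
    simpa using hi'
  have hsub' : ∀ i j, ¬ i < θ → i < j → i - θ < j - θ := fun i j hi hij => by
    obtain ⟨r, rfl⟩ := exists_add_of_le (not_lt.1 hi)
    obtain ⟨s, rfl⟩ := exists_add_of_le ((not_lt.1 hi).trans hij.le)
    simpa using hij
  refine ⟨fun i => if i < θ then f i else Sum.map (α + ·) (β + ·) (f' (i - θ)), ?_, ?_, ?_, ?_⟩
  · intro i hi p hp
    split_ifs at hp with h1
    · exact (h.left_lt i h1 p hp).trans_le le_self_add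
    · obtain ⟨q, hq, rfl⟩ : ∃ q, f' (i - θ) = Sum.inl q ∧ α + q = p := by
        cases hf : f' (i - θ) <;> simp_all
      gcongr
      exact h'.left_lt _ (hsub i h1 hi) q hq
  · intro i hi p hp
    split_ifs at hp with h1
    · exact (h.right_lt i h1 p hp).trans_le le_self_add
    · obtain ⟨q, hq, rfl⟩ : ∃ q, f' (i - θ) = Sum.inr q ∧ β + q = p := by
        cases hf : f' (i - θ) <;> simp_all
      gcongr
      exact h'.right_lt _ (hsub i h1 hi) q hq
  · intro i j hij hj p q hp hq
    split_ifs at hp hq with h1 h2 h2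
    · exact h.left_mono i j hij h2 p q hp hq
    · obtain ⟨q, -, rfl⟩ : ∃ q', f' (j - θ) = Sum.inl q' ∧ α + q' = q := by
        cases hf : f' (j - θ) <;> simp_all
      exact (h.left_lt i h1 p hp).trans_le le_self_add
    · exact absurd (hij.trans h2) h1
    · obtain ⟨p, hp', rfl⟩ : ∃ q', f' (i - θ) = Sum.inl q' ∧ α + q' = p := by
        cases hf : f' (i - θ) <;> simp_all
      obtain ⟨q, hq', rfl⟩ : ∃ q', f' (j - θ) = Sum.inl q' ∧ α + q' = q := by
        cases hf : f' (j - θ) <;> simp_all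
      gcongr
      exact h'.left_mono _ _ (hsub' i j h1 hij) (hsub j h2 hj) p q hp' hq'
  · intro i j hij hj p q hp hq
    split_ifs at hp hq with h1 h2 h2
    · exact h.right_mono i j hij h2 p q hp hq
    · obtain ⟨q, -, rfl⟩ : ∃ q', f' (j - θ) = Sum.inr q' ∧ β + q' = q := by
        cases hf : f' (j - θ) <;> simp_all
      exact (h.right_lt i h1 p hp).trans_le le_self_add
    · exact absurd (hij.trans h2) h1
    · obtain ⟨p, hp', rfl⟩ : ∃ q', f' (i - θ) = Sum.inr q' ∧ β + q' = p := by
        cases hf : f' (i - θ) <;> simp_all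
      obtain ⟨q, hq', rfl⟩ : ∃ q', f' (j - θ) = Sum.inr q' ∧ β + q' = q := by
        cases hf : f' (j - θ) <;> simp_all
      gcongr
      exact h'.right_mono _ _ (hsub' i j h1 hij) (hsub j h2 hj) p q hp' hq'

/-- Place the leading block of `α`, then that of `β`, then a shuffle of the remainders, which lie
below a smaller power of `ω`. -/
theorem exists_isShuffle_of_lt_opow (γ : Ordinal.{t}) : ∀ α < ω ^ γ, ∀ β < ω ^ γ,
    ∃ f, IsShuffle α β (natSum α β) f := by
  induction γ using WellFoundedLT.induction with
  | ind γ ih =>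
  intro α hα β hβ
  by_cases hαβ : α ≠ 0 ∨ β ≠ 0
  · obtain ⟨δ, hδ, m, n, x, hx, y, hy, rfl, rfl⟩ := exists_common_log α β γ hα hβ hαβ
    obtain ⟨f, hf⟩ := ih δ hδ x hx y hy
    obtain ⟨g, hg⟩ := (isShuffle_inl (ω ^ δ * m)).append (isShuffle_inr (ω ^ δ * n))
    rw [add_zero, zero_add] at hg
    obtain ⟨g', hg'⟩ := hg.append hf
    refine ⟨g', hg'.mono ?_⟩
    have := natSum_le_opow_mul_add (natSum_lt_opow δ) _ _ m n x y hx hy rfl rfl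
    rwa [Nat.cast_add, mul_add] at this
  · push Not at hαβ
    obtain ⟨rfl, rfl⟩ := hαβ
    exact ⟨Sum.inl, (isShuffle_inl 0).mono (natSum_le_iff.2 (by simp))⟩

/-- Two ordinals can be shuffled into a sequence of length their natural sum. -/
theorem exists_isShuffle (α β : Ordinal.{t}) : ∃ f, IsShuffle α β (natSum α β) f := by
  refine exists_isShuffle_of_lt_opow (Order.succ (max α β)) α ?_ β ?_
  · exact ((le_max_left α β).trans_lt (Order.lt_succ _)).trans_le (right_le_opow _ one_lt_omega0)
  · exact ((le_max_right α β).trans_lt (Order.lt_succ _)).trans_le (right_le_opow _ one_lt_omega0)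

end Ordinals

/-! ### Depth of dividing trees, and dividing chains -/

section Chains

variable {L : FirstOrder.Language.{u, v}} {M : Type w} [L.Structure M]
  {A : Set M} {T : L.Theory} {κ : Cardinal.{w}}

/-- The restriction to `ω^j` of a sequence in `ω^α`. -/
def below {α : Ordinal.{t}} (f : Set.Iio α → ℕ) (j : Set.Iio α) : Set.Iio j.1 → ℕ :=
  fun l => f ⟨l.1, lt_trans (Set.mem_Iio.1 l.2) (Set.mem_Iio.1 j.2)⟩

theorem isSmall_sigma_formula (hM : IsMonster T M κ) {ι : Type w} (hι : IsSmall κ ι) :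
    IsSmall κ (Σ n, L.Formula (ι ⊕ Fin n)) := by
  have hκ := hM.aleph0_lt
  have hbound : ∀ n : ℕ, Cardinal.mk (L.Formula (ι ⊕ Fin n)) ≤
      max Cardinal.aleph0 (Cardinal.lift.{max u v} (Cardinal.mk (ι ⊕ ℕ)) +
        Cardinal.lift.{w} L.card) := by
    intro n
    have h1 : Cardinal.mk (L.Formula (ι ⊕ Fin n)) ≤
        Cardinal.mk (Σ m, L.BoundedFormula (ι ⊕ Fin n) m) :=
      Cardinal.mk_le_of_injective (f := fun φ => ⟨0, φ⟩) (fun φ ψ h => by simpa using h)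
    have h2 : Cardinal.mk (ι ⊕ Fin n) ≤ Cardinal.mk (ι ⊕ ℕ) :=
      Cardinal.mk_le_of_injective (f := Sum.map id (fun i : Fin n => (i : ℕ)))
        (Function.injective_id.sumMap Fin.val_injective)
    exact h1.trans (BoundedFormula.card_le.trans
      (max_le_max le_rfl (add_le_add (Cardinal.lift_le.2 h2) le_rfl)))
  have hlt : max Cardinal.aleph0 (Cardinal.lift.{max u v} (Cardinal.mk (ι ⊕ ℕ)) +
        Cardinal.lift.{w} L.card) < Cardinal.lift.{max u v} κ := by
    have h0 : Cardinal.aleph0 < Cardinal.lift.{max u v} κ := Cardinal.aleph0_lt_lift.2 hκ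
    refine max_lt h0 (Cardinal.add_lt_of_lt h0.le ?_ ?_)
    · exact Cardinal.lift_lt.2 (hι.sum hκ.le (isSmall_of_countable hκ)).mk_lt
    · exact (Cardinal.lift_le.2 (le_max_right _ _)).trans_lt hM.card_lt
  refine isSmall_of_lift_lt ?_
  have hsum : Cardinal.mk (Σ n, L.Formula (ι ⊕ Fin n)) < Cardinal.lift.{max u v} κ := by
    rw [Cardinal.mk_sigma]
    refine (Cardinal.sum_le_sum _ _ hbound).trans_lt ?_
    rw [Cardinal.sum_const]
    refine Cardinal.mul_lt_of_lt (Cardinal.aleph0_le_lift.2 hκ.le) ?_ ?_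
    · simpa using hκ
    · simpa using hlt
  rw [Cardinal.lift_id'.{w, max u v}]
  exact hsum.trans_eq (congrFun Cardinal.lift_umax.{w, max u v}.symm κ)

/-- The levels in `S` carry the same formula and the same `k`, so each contributes one splitting.
`R` records the levels already passed; changing `f` at a later level does not affect their
parameters. -/
theorem splitRank_of_tree {ι : Type*} {α : Ordinal.{t}} {n : Set.Iio α → ℕ}
    {φ : ∀ j, L.Formula (ι ⊕ Fin (n j))} {k : Set.Iio α → ℕ}
    {b : ∀ j : Set.Iio α, (Set.Iio j.1 → ℕ) → ℕ → Fin (n j) → M}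
    (hk : ∀ (j : Set.Iio α) (s : Set.Iio j.1 → ℕ), KInconsistent (k j) (φ j) (b j s))
    (hb : ∀ f : Set.Iio α → ℕ,
      Consistent (Set.range fun j : Set.Iio α => inst (φ j) (b j (below f j) (f j))))
    {P : (Σ n, L.Formula (ι ⊕ Fin n)) × ℕ} (S : Finset (Set.Iio α))
    (hS : ∀ j ∈ S, ((⟨n j, φ j⟩, k j) : (Σ n, L.Formula (ι ⊕ Fin n)) × ℕ) = P)
    (R : Finset (Set.Iio α)) (hRS : ∀ i ∈ R, ∀ j ∈ S, i < j) (f : Set.Iio α → ℕ) :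
    SplitRank (splitFam M P.1 P.2) S.card
      {e | ∀ j ∈ R, (φ j).Realize (Sum.elim e (b j (below f j) (f j)))} := by
  classical
  induction S using Finset.induction_on_min generalizing R f with
  | empty =>
    obtain ⟨e, he⟩ := hb f ((fun j => inst (φ j) (b j (below f j) (f j))) '' R)
      (Set.image_subset_range _ _) (R.finite_toSet.image _)
    exact ⟨e, fun j hj => (sat_inst _ _ _).1 (he _ ⟨j, hj, rfl⟩)⟩
  | insert m S hm ih =>
    rw [Finset.card_insert_of_notMem fun h => lt_irrefl _ (hm m h)]
    refine ⟨fun i => {e | (φ m).Realize (Sum.elim e (b m (below f m) i))}, ?_, fun i => ?_⟩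
    · rw [← hS m (Finset.mem_insert_self m S)]
      exact ⟨fun i => b m (below f m) i, hk m _, fun i => rfl⟩
    · refine (ih (fun j hj => hS j (Finset.mem_insert_of_mem hj)) (insert m R) ?_
        (Function.update f m i)).mono fun e he => ?_
      · intro i hi j hj
        rcases Finset.mem_insert.1 hi with rfl | hi
        · exact hm j hj
        · exact hRS i hi j (Finset.mem_insert_of_mem hj)
      · have hbelow : ∀ j ≤ m, below (Function.update f m i) j = below f j := fun j hj => by
          funext l
          refine Function.update_of_ne (fun h => ?_) _ _
          have : l.1 = m.1 := congrArg Subtype.val h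
          exact absurd (this ▸ Set.mem_Iio.1 l.2) (not_lt.2 (Subtype.coe_le_coe.2 hj))
        refine ⟨fun j hj => ?_, ?_⟩
        · have hjm := hRS j hj m (Finset.mem_insert_self m S)
          have := he j (Finset.mem_insert_of_mem hj)
          rwa [hbelow j hjm.le, Function.update_of_ne hjm.ne] at this
        · have := he m (Finset.mem_insert_self m R)
          rwa [hbelow m le_rfl, Function.update_self] at this

/-- In a simple theory, the depth of a dividing tree is small. -/
theorem PlusLeDD.isSmall (hM : IsMonster T M κ) (hT : IsSimple.{u, v, w} T) {ι : Type w}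
    (hι : IsSmall κ ι) {α : Ordinal.{t}} {p : Set (ParamFormula L M ι)} (h : PlusLeDD α p) :
    IsSmall κ (Set.Iio α) := by
  classical
  obtain ⟨n, φ, k, b, hk, hb⟩ := h
  let c : Set.Iio α → (Σ n, L.Formula (ι ⊕ Fin n)) × ℕ := fun j => (⟨n j, φ j⟩, k j)
  -- The rank bound lets each pair of a formula and a number label only finitely many levels, so the
  -- levels inject into a small set.
  have hfin : ∀ P, (c ⁻¹' {P}).Finite := by
    intro P
    by_contra hinf
    obtain ⟨N, hN⟩ := exists_not_splitRank hM hT P.1 P.2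
    obtain ⟨S, hS, hcard⟩ := Set.Infinite.exists_subset_card_eq hinf N
    have := splitRank_of_tree hk (fun f q hq hqf => hb f q (hq.trans Set.subset_union_right) hqf)
      (P := P) S (fun j hj => hS hj) ∅ (by simp) 0
    rw [hcard] at this
    exact hN (this.mono (Set.subset_univ _))
  have hfin' : ∀ P, ∃ g : c ⁻¹' {P} → ℕ, Function.Injective g := fun P => by
    have := (hfin P).countable.to_subtype
    exact exists_injective_nat _
  choose g hg using hfin'
  have hκ := hM.aleph0_lt
  refine (((isSmall_sigma_formula hM hι).prod hκ.le (isSmall_of_countable hκ (V := ℕ))).prod hκ.le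
    (isSmall_of_countable hκ (V := ℕ))).of_injective (f := fun j => (c j, g (c j) ⟨j, rfl⟩)) ?_
  intro i j hij
  have h1 : c i = c j := congrArg Prod.fst hij
  have h2 : g (c i) ⟨i, rfl⟩ = g (c j) ⟨j, rfl⟩ := congrArg Prod.snd hij
  have h3 : ∀ P Q (hi : c i = P) (hj : c j = Q), P = Q → g P ⟨i, hi⟩ = g Q ⟨j, hj⟩ → i = j := by
    rintro P _ hi hj rfl h
    exact congrArg Subtype.val (hg P h)
  exact h3 _ _ rfl rfl h1 h2

/-- `e` is a dividing chain for `a` over `A`. -/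
structure DivChain {ι J : Type*} [LT J] (A : Set M) (a : ι → M) (n : J → ℕ)
    (φ : ∀ j, L.Formula (ι ⊕ Fin (n j))) (k : J → ℕ) (e : (Σ j, Fin (n j)) → M) : Prop where
  mem : ∀ j, (φ j).Realize (Sum.elim a fun r => e ⟨j, r⟩)
  div : ∀ j, SDiv L (A ∪ e '' {q | q.1 < j}) (k j)
    {x | (φ j).Realize (Sum.elim x fun r => e ⟨j, r⟩)}

theorem DivChain.comp {ι J : Type*} [LT J] {a : ι → M} {n : J → ℕ}
    {φ : ∀ j, L.Formula (ι ⊕ Fin (n j))} {k : J → ℕ} {e : (Σ j, Fin (n j)) → M}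
    (h : DivChain A a n φ k e) {τ : M ≃[L] M} (hτ : Fixes A τ) :
    DivChain A (τ ∘ a) n φ k (τ ∘ e) where
  mem j := by
    rw [realize_elim_comp]
    convert h.mem j using 2
    ext r; simp
  div j := by
    obtain ⟨σ, hσ, hσk⟩ := h.div j
    refine ⟨fun i => (τ.comp (σ i)).comp τ.symm, fun i => ?_, fun s hs ⟨x, hx⟩ => ?_⟩
    · rintro _ (hb | ⟨q, hq, rfl⟩)
      · exact ((hτ.comp ((hσ i).mono Set.subset_union_left)).comp hτ.symm) _ hb
      · simp only [Equiv.comp_apply, Function.comp]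
        rw [show τ.symm (τ (e q)) = e q from τ.symm_apply_apply _,
          hσ i _ (Or.inr ⟨q, hq, rfl⟩)]
    · refine hσk s hs ⟨τ.symm ∘ x, fun i hi => ?_⟩
      have := hx i hi
      rw [Set.mem_ofPred_eq, comp_comp_eq, comp_comp_eq, realize_elim_comp] at this
      rw [Set.mem_ofPred_eq]
      convert this using 2
      ext r; simp

end Chains

/-! ### From trees to chains -/

section Trees

variable {L : FirstOrder.Language.{u, v}} {M : Type w} [L.Structure M]
  {A : Set M} {T : L.Theory} {κ : Cardinal.{w}}

/-- A dividing tree in the type of `a` over `B` yields a dividing chain for `a` over any small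
subset of `B`. -/
theorem PlusLeDD.exists_divChain (hM : IsMonster T M κ) {ι : Type*} (hι : IsSmall κ ι)
    (hA : IsSmall κ A) {B : Set M} (hAB : A ⊆ B) {α : Ordinal.{t}} (hα : IsSmall κ (Set.Iio α))
    {a : ι → M} (h : PlusLeDD α (tp L B a)) :
    ∃ (n : Set.Iio α → ℕ) (φ : ∀ j, L.Formula (ι ⊕ Fin (n j))) (k : Set.Iio α → ℕ)
      (e : (Σ j, Fin (n j)) → M), DivChain A a n φ k e := by
  classical
  have := hM.nonempty
  have hκ := hM.aleph0_lt
  obtain ⟨n, φ, k, b, hk, hb⟩ := h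
  let Q := Σ j, Fin (n j)
  let V := ι ⊕ (Q ⊕ (Q × ℕ))
  have hQ : IsSmall κ Q := hα.sigma_fin hκ n
  have hV : IsSmall κ V :=
    hι.sum hκ.le (hQ.sum hκ.le (hQ.prod hκ.le (isSmall_of_countable hκ)))
  -- The unknowns are a copy of `a` (`vx`), the chain (`ve`) and, for each level, a sequence
  -- witnessing dividing (`vd`). The condition `c3` says that the witnesses have the type of the
  -- chain element over `A` and the earlier chain.
  let vx : ι → V := Sum.inl
  let ve : Q → V := fun q => Sum.inr (Sum.inl q)
  let vd : ℕ → Q → V := fun i q => Sum.inr (Sum.inr (q, i))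
  let H := fun j : Set.Iio α => {q : Q // q.1 < j} ⊕ Fin (n j)
  let me : ∀ j, H j → V := fun j => Sum.elim (fun q => ve q) (fun r => ve ⟨j, r⟩)
  let md : ∀ j, ℕ → H j → V := fun j i => Sum.elim (fun q => ve q) (fun r => vd i ⟨j, r⟩)
  let c1 : Set (ι → M) → Set (V → M) := fun Y => {v | v ∘ vx ∈ Y}
  let c2 : Set.Iio α → Set (V → M) := fun j =>
    {v | (φ j).Realize (v ∘ Sum.elim vx fun r => ve ⟨j, r⟩)}
  let c3 : (Σ j, Set (H j → M)) → ℕ → Set (V → M) := fun p i =>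
    {v | v ∘ me p.1 ∈ p.2 → v ∘ md p.1 i ∈ p.2}
  let c4 : Set.Iio α → Finset ℕ → Set (V → M) := fun j s =>
    {v | ¬ ∃ x : ι → M, ∀ i ∈ s, (φ j).Realize (Sum.elim x fun r => v (vd i ⟨j, r⟩))}
  obtain ⟨v, hv⟩ := hM.exists_mem_of_fip hA hV
    (𝒳 := {Z | (∃ Y, IsDef L A Y ∧ a ∈ Y ∧ Z = c1 Y) ∨ (∃ j, Z = c2 j) ∨
      (∃ p i, IsDef L A p.2 ∧ Z = c3 p i) ∨ ∃ j s, s.card = k j ∧ Z = c4 j s}) (by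
      rintro _ (⟨Y, hY, -, rfl⟩ | ⟨j, rfl⟩ | ⟨p, i, hp, rfl⟩ | ⟨j, s, -, rfl⟩)
      · exact hY.preimage _
      · exact (isDef_realize (φ j)).preimage _
      · refine ((hp.preimage (me p.1)).inter (hp.preimage (md p.1 i)).compl).compl.congr fun v => ?_
        simp [c3]
      · refine (IsDef.exists_left (IsDef.iInter_finset s (fun i => {w : ι ⊕ V → M |
          (φ j).Realize (Sum.elim (w ∘ Sum.inl) fun r => w (Sum.inr (vd i ⟨j, r⟩)))})
          fun i _ => ?_)).compl
        refine ((isDef_realize (φ j)).preimage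
          (Sum.map id fun r => vd i ⟨j, r⟩)).congr fun w => ?_
        refine iff_of_eq (congrArg (φ j).Realize ?_)
        ext (_ | _) <;> rfl) (by
      intro F hF
      have hW : ∃ 𝒲 : Finset (Σ j, Set (H j → M)), ∀ Z ∈ F,
          (∃ Y, IsDef L A Y ∧ a ∈ Y ∧ Z = c1 Y) ∨ (∃ j, Z = c2 j) ∨
          (∃ p i, p ∈ 𝒲 ∧ Z = c3 p i) ∨ ∃ j s, s.card = k j ∧ Z = c4 j s := by
        have : ∀ Z ∈ F, ∃ 𝒲 : Finset (Σ j, Set (H j → M)),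
            (∃ Y, IsDef L A Y ∧ a ∈ Y ∧ Z = c1 Y) ∨ (∃ j, Z = c2 j) ∨
            (∃ p i, p ∈ 𝒲 ∧ Z = c3 p i) ∨ ∃ j s, s.card = k j ∧ Z = c4 j s := by
          intro Z hZ
          rcases hF hZ with h | h | ⟨p, i, -, h⟩ | h
          · exact ⟨∅, Or.inl h⟩
          · exact ⟨∅, Or.inr (Or.inl h)⟩
          · exact ⟨{p}, Or.inr (Or.inr (Or.inl ⟨p, i, by simp, h⟩))⟩
          · exact ⟨∅, Or.inr (Or.inr (Or.inr h))⟩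
        choose! 𝒲 h𝒲 using this
        refine ⟨F.biUnion 𝒲, fun Z hZ => ?_⟩
        rcases h𝒲 Z hZ with h | h | ⟨p, i, hp, h⟩ | h
        · exact Or.inl h
        · exact Or.inr (Or.inl h)
        · exact Or.inr (Or.inr (Or.inl ⟨p, i, Finset.mem_biUnion.2 ⟨Z, hZ, hp⟩, h⟩))
        · exact Or.inr (Or.inr (Or.inr h))
      obtain ⟨𝒲, h𝒲⟩ := hW
      let hist : ∀ j : Set.Iio α, (Set.Iio j.1 → ℕ) → {q : Q // q.1 < j} → M := fun j s q =>
        b q.1.1 (fun l => s ⟨l.1, lt_trans (Set.mem_Iio.1 l.2) q.2⟩) (s ⟨q.1.1.1, q.2⟩) q.1.2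
      -- Only finitely many sets `W` matter for `F`, so by pigeonhole infinitely many children of a
      -- node agree on all of them over its history.
      have hpick : ∀ (j : Set.Iio α) (s : Set.Iio j.1 → ℕ), ∃ g : ℕ → ℕ, Function.Injective g ∧
          ∀ i W, ⟨j, W⟩ ∈ 𝒲 → Sum.elim (hist j s) (b j s (g 0)) ∈ W →
            Sum.elim (hist j s) (b j s (g i)) ∈ W := by
        intro j s
        let 𝒲j : Set (Set (H j → M)) := {W | (⟨j, W⟩ : Σ j, Set (H j → M)) ∈ 𝒲}
        have hfin : Finite 𝒲j :=
          (𝒲.finite_toSet.preimage (f := fun W => (⟨j, W⟩ : Σ j, Set (H j → M)))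
            (fun _ _ _ _ h => by simpa using h)).to_subtype
        obtain ⟨c, g, hg, hgc⟩ := exists_injective_const
          (fun i (W : 𝒲j) => Sum.elim (hist j s) (b j s i) ∈ W.1)
        refine ⟨g, hg, fun i W hW h0 => ?_⟩
        have h1 := congrFun (hgc 0) ⟨W, hW⟩
        have h2 := congrFun (hgc i) ⟨W, hW⟩
        simp only at h1 h2
        rw [h2, ← h1]
        exact h0
      choose g hg hgW using hpick
      -- The branch always follows the first child of the thinned family; its siblings in that
      -- family serve as witnesses.
      let f : Set.Iio α → ℕ := IsWellFounded.fix (· < ·) fun j ih =>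
        g j (fun l => ih ⟨l.1, lt_trans (Set.mem_Iio.1 l.2) (Set.mem_Iio.1 j.2)⟩ l.2) 0
      have hf : ∀ j, f j = g j (below f j) 0 := fun j => IsWellFounded.fix_eq _ _ _
      let pv : (ι → M) → V → M := fun x => Sum.elim x (Sum.elim
        (fun q => b q.1 (below f q.1) (f q.1) q.2)
        (fun p => b p.1.1 (below f p.1.1) (g p.1.1 (below f p.1.1) p.2) p.1.2))
      have hq : ∀ Z ∈ F, ∃ q : Set (ParamFormula L M ι), q ⊆ tp L B a ∪ Set.range
          (fun j : Set.Iio α => inst (φ j) (b j (below f j) (f j))) ∧ q.Finite ∧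
          ∀ x, (∀ θ ∈ q, Sat θ x) → pv x ∈ Z := by
        intro Z hZ
        rcases h𝒲 Z hZ with ⟨Y, hY, haY, rfl⟩ | ⟨j, rfl⟩ | ⟨p, i, hp, rfl⟩ | ⟨j, s, hs, rfl⟩
        · obtain ⟨θ, hθ, hYθ⟩ := (hY.mono hAB).exists_isOver
          refine ⟨{θ}, ?_, Set.finite_singleton _, fun x hx => (hYθ x).2 (hx θ rfl)⟩
          rintro _ rfl
          exact Or.inl ⟨hθ, (hYθ a).1 haY⟩
        · refine ⟨{inst (φ j) (b j (below f j) (f j))}, ?_, Set.finite_singleton _, fun x hx => ?_⟩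
          · rintro _ rfl
            exact Or.inr ⟨j, rfl⟩
          · have := (sat_inst _ _ _).1 (hx _ rfl)
            refine (iff_of_eq (congrArg (φ j).Realize ?_)).1 this
            ext (_ | _) <;> rfl
        · refine ⟨∅, Set.empty_subset _, Set.finite_empty, fun x _ => ?_⟩
          obtain ⟨j, W⟩ := p
          have := hgW j (below f j) i W hp
          rw [← hf] at this
          have e1 : pv x ∘ me j = Sum.elim (hist j (below f j)) (b j (below f j) (f j)) := by
            ext (_ | _) <;> rfl
          have e2 : pv x ∘ md j i =
              Sum.elim (hist j (below f j)) (b j (below f j) (g j (below f j) i)) := by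
            ext (_ | _) <;> rfl
          change pv x ∘ me j ∈ W → pv x ∘ md j i ∈ W
          rwa [e1, e2]
        · refine ⟨∅, Set.empty_subset _, Set.finite_empty, fun x _ => ?_⟩
          rintro ⟨x', hx'⟩
          exact (hk j (below f j)).comp_injective (hg j (below f j)) s hs
            ⟨x', fun i hi => (sat_inst _ _ _).2 (hx' i hi)⟩
      choose! q hqs hqf hqx using hq
      obtain ⟨x, hx⟩ := hb f (⋃ Z ∈ F, q Z) (Set.iUnion₂_subset hqs)
        (F.finite_toSet.biUnion hqf)
      exact ⟨pv x, fun Z hZ => hqx Z hZ x fun θ hθ => hx θ (Set.mem_biUnion hZ hθ)⟩)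
  obtain ⟨τ, hτ, hτa⟩ := hM.exists_fixes_of_tpEq hA (hι.range a) (d := v ∘ vx)
    (fun Y hY ha => hv (c1 Y) (Or.inl ⟨Y, hY, ha, rfl⟩))
  have hchain : DivChain A (v ∘ vx) n φ k (v ∘ ve) := by
    refine ⟨fun j => ?_, fun j => ?_⟩
    · have := hv (c2 j) (Or.inr (Or.inl ⟨j, rfl⟩))
      refine (iff_of_eq (congrArg (φ j).Realize ?_)).1 this
      ext (_ | _) <;> rfl
    · have hsmall : IsSmall κ (A ∪ (v ∘ ve) '' {q | q.1 < j} : Set M) :=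
        hA.union hκ.le ((hQ.range (v ∘ ve)).subset (Set.image_subset_range _ _))
      refine sDiv_of_kInconsistent hM hsmall (d := fun i r => v (vd i ⟨j, r⟩)) (fun i => ?_) ?_
      · intro W hW hmem
        rw [show (v ∘ ve) '' {q | q.1 < j} = Set.range (fun q : {q : Q // q.1 < j} => v (ve q)) by
          ext m; simp] at hW
        obtain ⟨Y, hY, hWY⟩ := hW.exists_of_union_range
        have e1 : v ∘ me j = Sum.elim (fun q : {q : Q // q.1 < j} => v (ve q))
              (fun r => v (ve ⟨j, r⟩)) := by
          ext (_ | _) <;> rfl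
        have e2 : v ∘ md j i = Sum.elim (fun q : {q : Q // q.1 < j} => v (ve q))
              (fun r => v (vd i ⟨j, r⟩)) := by
          ext (_ | _) <;> rfl
        have h3 : v ∘ me j ∈ Y → v ∘ md j i ∈ Y :=
          hv (c3 ⟨j, Y⟩ i) (Or.inr (Or.inr (Or.inl ⟨⟨j, Y⟩, i, hY, rfl⟩)))
        rw [e1, e2] at h3
        exact (hWY _).2 (h3 ((hWY _).1 hmem))
      · intro s hs ⟨x, hx⟩
        exact hv (c4 j s) (Or.inr (Or.inr (Or.inr ⟨j, s, hs, rfl⟩)))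
          ⟨x, fun i hi => (sat_inst _ _ _).1 (hx i hi)⟩
  refine ⟨n, φ, k, τ.symm ∘ v ∘ ve, ?_⟩
  have := hchain.comp hτ.symm
  rwa [← hτa, symm_comp_comp] at this

end Trees

/-! ### From chains to trees -/

section TreeOfChain

variable {L : FirstOrder.Language.{u, v}} {M : Type w} [L.Structure M]
  {A : Set M} {T : L.Theory} {κ : Cardinal.{w}}

/-- A dividing chain for `a` over `A` yields a dividing tree in the type of `a` over `A`. -/
theorem DivChain.plusLeDD (hM : IsMonster T M κ) {ι : Type*} (hA : IsSmall κ A) {γ : Ordinal.{t}}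
    {a : ι → M} {n : Set.Iio γ → ℕ} {φ : ∀ j, L.Formula (ι ⊕ Fin (n j))} {k : Set.Iio γ → ℕ}
    {e : (Σ j, Fin (n j)) → M} (h : DivChain A a n φ k e) (he : IsSmall κ (Set.range e)) :
    PlusLeDD γ (tp L A a) := by
  classical
  choose σ hσ hσk using h.div
  -- `C` says that `ρ` fixes `A` and carries the chain below `j` onto the path `s`. The children of
  -- `s` are the `ρ`-images of the dividing conjugates of `e_j`. The identity default in `R` is
  -- harmless: any automorphism preserves `k`-inconsistency, and `hall` shows that a suitable `ρ`
  -- always exists.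
  let C : ∀ j : Set.Iio γ, (∀ l : Set.Iio γ, l < j → (Set.Iio l.1 → ℕ) → ℕ → Fin (n l) → M) →
      (Set.Iio j.1 → ℕ) → (M ≃[L] M) → Prop := fun j ih s ρ =>
    Fixes A ρ ∧ ∀ (q : Σ j, Fin (n j)) (hq : q.1 < j), ρ (e q) =
      ih q.1 hq (fun l => s ⟨l.1, lt_trans (Set.mem_Iio.1 l.2) hq⟩) (s ⟨q.1.1, hq⟩) q.2
  let R : ∀ j : Set.Iio γ, (∀ l : Set.Iio γ, l < j → (Set.Iio l.1 → ℕ) → ℕ → Fin (n l) → M) →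
      (Set.Iio j.1 → ℕ) → (M ≃[L] M) := fun j ih s =>
    if h : ∃ ρ, C j ih s ρ then h.choose else FirstOrder.Language.Equiv.refl L M
  let G : ∀ j : Set.Iio γ, (Set.Iio j.1 → ℕ) → ℕ → Fin (n j) → M :=
    IsWellFounded.fix (· < ·) fun j ih s i r => R j ih s ((σ j i).symm (e ⟨j, r⟩))
  have hG : ∀ j s i r, G j s i r = R j (fun l _ => G l) s ((σ j i).symm (e ⟨j, r⟩)) :=
    fun j s i r => by
      have := IsWellFounded.fix_eq (α := Set.Iio γ) (· < ·)
        (motive := fun j => (Set.Iio j.1 → ℕ) → ℕ → Fin (n j) → M)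
        (fun j ih s i r => R j ih s ((σ j i).symm (e ⟨j, r⟩))) j
      exact congrFun (congrFun (congrFun this s) i) r
  have hstep : ∀ (f : Set.Iio γ → ℕ) (Q : Set (Set.Iio γ)),
      (∀ l ∈ Q, ∃ ρ, C l (fun l _ => G l) (below f l) ρ) →
      ∃ ρ : M ≃[L] M, Fixes A ρ ∧ ∀ q : {q : Σ j, Fin (n j) // q.1 ∈ Q},
        ρ (e q) = G q.1.1 (below f q.1.1) (f q.1.1) q.1.2 := by
    intro f Q hQ
    obtain ⟨ρ, hρ, hρe⟩ := hM.exists_fixes_of_finset (V := {q : Σ j, Fin (n j) // q.1 ∈ Q}) hA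
      (c := fun q => e q) (d := fun q => G q.1.1 (below f q.1.1) (f q.1.1) q.1.2)
      (he.subset (by rintro _ ⟨q, rfl⟩; exact ⟨q, rfl⟩)) (by
        intro F
        rcases F.eq_empty_or_nonempty with rfl | hF
        · exact ⟨FirstOrder.Language.Equiv.refl L M, fun _ _ => rfl, by simp⟩
        obtain ⟨q₀, hq₀, hmax⟩ := F.exists_max_image (fun q => q.1.1) hF
        have hex := hQ q₀.1.1 q₀.2
        have hR : C q₀.1.1 (fun l _ => G l) (below f q₀.1.1)
            (R q₀.1.1 (fun l _ => G l) (below f q₀.1.1)) := by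
          simp only [R, dif_pos hex]
          exact hex.choose_spec
        -- At the highest level that occurs in `F`, `(σ _ _).symm` moves that chain element to the
        -- chosen conjugate and fixes the earlier ones, which `R` then sends to the path.
        -- Homogeneity handles infinitely many levels at once.
        refine ⟨(R q₀.1.1 (fun l _ => G l) (below f q₀.1.1)).comp (σ q₀.1.1 (f q₀.1.1)).symm,
          hR.1.comp ((hσ _ _).mono Set.subset_union_left).symm, ?_⟩
        rintro ⟨⟨l, r⟩, hl⟩ hqF
        rcases (hmax _ hqF).lt_or_eq with hlt | heq
        · rw [Equiv.comp_apply, (hσ q₀.1.1 (f q₀.1.1)).symm _ (Or.inr ⟨⟨l, r⟩, hlt, rfl⟩)]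
          exact hR.2 ⟨l, r⟩ hlt
        · simp only at heq
          subst heq
          exact (hG _ _ _ _).symm)
    exact ⟨ρ, hρ, fun q => congrFun hρe q⟩
  have hall : ∀ (f : Set.Iio γ → ℕ) (j : Set.Iio γ),
      ∃ ρ, C j (fun l _ => G l) (below f j) ρ := by
    intro f j
    induction j using WellFoundedLT.induction with
    | ind j ih =>
      obtain ⟨ρ, hρ, hρe⟩ := hstep f {l | l < j} ih
      exact ⟨ρ, hρ, fun q hq => hρe ⟨q, hq⟩⟩
  refine ⟨n, φ, k, G, fun j s t ht => ?_, fun f q hq _ => ?_⟩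
  · rintro ⟨x, hx⟩
    let ρ := R j (fun l _ => G l) s
    refine hσk j t ht ⟨ρ.symm ∘ x, fun i hi => ?_⟩
    have := (sat_inst _ _ _).1 (hx i hi)
    rw [show G j s i = ρ ∘ (σ j i).symm ∘ (fun r => e ⟨j, r⟩) from funext fun r => hG j s i r] at this
    rw [Set.mem_ofPred_eq, realize_elim_comp, realize_elim_comp]
    exact this
  · obtain ⟨ρ, hρ, hρe⟩ := hstep f Set.univ fun j _ => hall f j
    refine ⟨ρ ∘ a, fun θ hθ => ?_⟩
    rcases hq hθ with ⟨hover, hsat⟩ | ⟨j, rfl⟩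
    · exact tpEq_comp_of_fixes hρ a _ (IsOver.isDef hover) hsat
    · rw [sat_inst, realize_elim_comp]
      convert h.mem j using 2
      ext r
      have := hρe ⟨⟨j, r⟩, trivial⟩
      change ρ.symm (G j (below f j) (f j) r) = _
      rw [← this]
      exact ρ.symm_apply_apply _

end TreeOfChain

/-! ### Making chains independent and shuffling them -/

section Sum

variable {L : FirstOrder.Language.{u, v}} {M : Type w} [L.Structure M]
  {A : Set M} {T : L.Theory} {κ : Cardinal.{w}} {ι ι' D J : Type*}

/-- A dividing chain for `b` can be moved so that a tuple that is independent from `b` is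
independent from the chain. -/
theorem DivChain.exists_nonDividing [LT J] (hM : IsMonster T M κ) (hA : IsSmall κ A)
    (hι : IsSmall κ ι) (hD : IsSmall κ D) (hJ : IsSmall κ J) {b : ι → M} {n : J → ℕ}
    {φ : ∀ j, L.Formula (ι ⊕ Fin (n j))} {k : J → ℕ} {e : (Σ j, Fin (n j)) → M}
    (h : DivChain A b n φ k e) {d : D → M} (hd : NonForking L A (A ∪ Set.range b) d) :
    ∃ e', DivChain A b n φ k e' ∧ NonDividing L A (A ∪ Set.range (Sum.elim b e')) d := by
  have hκ := hM.aleph0_lt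
  -- Extension moves `d` over `Ab` to be independent from `be`; applying `τ.symm` instead keeps `d`
  -- and `b` and moves the chain.
  obtain ⟨τ, hτ, hnd⟩ := hd.exists_fixes hM (hA.union hκ.le (hι.range b))
    (hA.union hκ.le ((hι.sum hκ.le (hJ.sigma_fin hκ n)).range (Sum.elim b e))) hD
  have hτA : Fixes A τ := hτ.mono Set.subset_union_left
  have hτb : ∀ i, τ (b i) = b i := fun i => hτ _ (Or.inr ⟨i, rfl⟩)
  refine ⟨τ.symm ∘ e, ?_, hnd.of_comp hτA ?_⟩
  · have := h.comp hτA.symm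
    rwa [show τ.symm ∘ b = b from funext fun i => hτ.symm _ (Or.inr ⟨i, rfl⟩)] at this
  · rintro _ (hx | ⟨i | q, rfl⟩)
    · rw [hτA _ hx]; exact Or.inl hx
    · exact Or.inr ⟨Sum.inl i, (hτb i).symm⟩
    · exact Or.inr ⟨Sum.inr q, (τ.apply_symm_apply _).symm⟩

theorem DivChain.sDiv_union_range [LT J] (hM : IsMonster T M κ) (hA : IsSmall κ A)
    (hι : IsSmall κ ι) (hD : IsSmall κ D) (hJ : IsSmall κ J) {b : ι → M} {n : J → ℕ}
    {φ : ∀ j, L.Formula (ι ⊕ Fin (n j))} {k : J → ℕ} {e : (Σ j, Fin (n j)) → M}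
    (h : DivChain A b n φ k e) {d : D → M}
    (hd : NonDividing L A (A ∪ Set.range (Sum.elim b e)) d) (j : J) :
    SDiv L ((A ∪ e '' {q | q.1 < j}) ∪ Set.range d) (k j)
      {x | (φ j).Realize (Sum.elim x fun r => e ⟨j, r⟩)} := by
  have hκ := hM.aleph0_lt
  refine (h.div j).union_range hM
    (hA.union hκ.le ((hι.sum hκ.le (hJ.sigma_fin hκ n)).range (Sum.elim b e)))
    (Set.union_subset_union_right _ ?_) hD (hd.base_mono Set.subset_union_left)
    (isDef_realize_param _ _ fun r => Or.inr ⟨Sum.inr ⟨j, r⟩, rfl⟩)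
  rintro _ ⟨q, -, rfl⟩
  exact ⟨Sum.inr q, rfl⟩

theorem SDiv.congr {B : Set M} {k : ℕ} {X Y : Set (ι → M)} (h : SDiv L B k X)
    (hXY : ∀ e, e ∈ Y ↔ e ∈ X) : SDiv L B k Y := by
  rwa [show Y = X from Set.ext hXY]

theorem SDiv.cylinder {B : Set M} {k : ℕ} {X : Set (ι → M)} (h : SDiv L B k X) (f : ι → ι') :
    SDiv L B k {x : ι' → M | x ∘ f ∈ X} := by
  obtain ⟨σ, hσ, hσk⟩ := h
  exact ⟨σ, hσ, fun s hs ⟨x, hx⟩ => hσk s hs ⟨x ∘ f, hx⟩⟩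

theorem realize_relabel_map {n : ℕ} (φ : L.Formula (ι ⊕ Fin n)) (f : ι → ι') (x : ι' → M)
    (c : Fin n → M) :
    (φ.relabel (Sum.map f id)).Realize (Sum.elim x c) ↔ φ.Realize (Sum.elim (x ∘ f) c) := by
  rw [Formula.realize_relabel, Sum.elim_comp_map]; rfl

/-- Two dividing chains that keep dividing over each other can be shuffled. -/
theorem DivChain.shuffle {α β γ : Ordinal.{t}} {f} (hf : IsShuffle α β γ f)
    {a : ι → M} {n : Set.Iio α → ℕ} {φ : ∀ j, L.Formula (ι ⊕ Fin (n j))} {k : Set.Iio α → ℕ}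
    {e : (Σ j, Fin (n j)) → M} (ha : DivChain A a n φ k e)
    {b : ι' → M} {n' : Set.Iio β → ℕ} {ψ : ∀ j, L.Formula (ι' ⊕ Fin (n' j))} {k' : Set.Iio β → ℕ}
    {e' : (Σ j, Fin (n' j)) → M} (hb : DivChain A b n' ψ k' e')
    (hae : ∀ j, SDiv L ((A ∪ e '' {q | q.1 < j}) ∪ Set.range e') (k j)
      {x | (φ j).Realize (Sum.elim x fun r => e ⟨j, r⟩)})
    (hbe : ∀ j, SDiv L ((A ∪ e' '' {q | q.1 < j}) ∪ Set.range e) (k' j)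
      {x | (ψ j).Realize (Sum.elim x fun r => e' ⟨j, r⟩)}) :
    ∃ (N : Set.Iio γ → ℕ) (Φ : ∀ j, L.Formula ((ι ⊕ ι') ⊕ Fin (N j))) (K : Set.Iio γ → ℕ)
      (E : (Σ j, Fin (N j)) → M), DivChain A (Sum.elim a b) N Φ K E ∧
        Set.range E ⊆ Set.range e ∪ Set.range e' := by
  have hh : ∀ j : Set.Iio γ, ∃ z : Set.Iio α ⊕ Set.Iio β,
      f j.1 = Sum.map Subtype.val Subtype.val z := by
    intro j
    rcases hj : f j.1 with p | p
    · exact ⟨Sum.inl ⟨p, hf.left_lt j.1 j.2 p hj⟩, rfl⟩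
    · exact ⟨Sum.inr ⟨p, hf.right_lt j.1 j.2 p hj⟩, rfl⟩
  choose h hh using hh
  have hl : ∀ i j p q, i < j → h i = Sum.inl p → h j = Sum.inl q → p < q :=
    fun i j p q hij hi hj => hf.left_mono i.1 j.1 hij j.2 p.1 q.1 (by rw [hh, hi]; rfl)
      (by rw [hh, hj]; rfl)
  have hr : ∀ i j p q, i < j → h i = Sum.inr p → h j = Sum.inr q → p < q :=
    fun i j p q hij hi hj => hf.right_mono i.1 j.1 hij j.2 p.1 q.1 (by rw [hh, hi]; rfl)
      (by rw [hh, hj]; rfl)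
  let N : Set.Iio α ⊕ Set.Iio β → ℕ := Sum.elim n n'
  let Φ : ∀ z, L.Formula ((ι ⊕ ι') ⊕ Fin (N z)) := fun z => match z with
    | Sum.inl p => (φ p).relabel (Sum.map Sum.inl id)
    | Sum.inr q => (ψ q).relabel (Sum.map Sum.inr id)
  let E : ∀ z, Fin (N z) → M := fun z => match z with
    | Sum.inl p => fun r => e ⟨p, r⟩
    | Sum.inr q => fun r => e' ⟨q, r⟩
  have hmem : ∀ z, (Φ z).Realize (Sum.elim (Sum.elim a b) (E z)) := by
    rintro (p | q)
    · exact (realize_relabel_map _ _ _ _).2 (ha.mem p)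
    · exact (realize_relabel_map _ _ _ _).2 (hb.mem q)
  let base : Set.Iio α ⊕ Set.Iio β → Set M := fun z => match z with
    | Sum.inl p => (A ∪ e '' {q | q.1 < p}) ∪ Set.range e'
    | Sum.inr p => (A ∪ e' '' {q | q.1 < p}) ∪ Set.range e
  have hdiv : ∀ z, SDiv L (base z) (Sum.elim k k' z)
      {x | (Φ z).Realize (Sum.elim x (E z))} := by
    rintro (p | q)
    · exact ((hae p).cylinder Sum.inl).congr fun x => realize_relabel_map _ _ _ _
    · exact ((hbe q).cylinder Sum.inr).congr fun x => realize_relabel_map _ _ _ _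
  -- An earlier element of the same chain lies in the base by monotonicity of the shuffle; one of
  -- the other chain always does.
  have hbase : ∀ zi zj (r : Fin (N zi)), (∀ p q, zi = Sum.inl p → zj = Sum.inl q → p < q) →
      (∀ p q, zi = Sum.inr p → zj = Sum.inr q → p < q) → E zi r ∈ base zj := by
    rintro (q | q) (p | p) r hl hr
    · exact Or.inl (Or.inr ⟨⟨q, r⟩, hl q p rfl rfl, rfl⟩)
    · exact Or.inr ⟨⟨q, r⟩, rfl⟩
    · exact Or.inr ⟨⟨q, r⟩, rfl⟩
    · exact Or.inl (Or.inr ⟨⟨q, r⟩, hr q p rfl rfl, rfl⟩)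
  have hErange : ∀ z r, E z r ∈ Set.range e ∪ Set.range e' := by
    rintro (q | q) r
    · exact Or.inl ⟨⟨q, r⟩, rfl⟩
    · exact Or.inr ⟨⟨q, r⟩, rfl⟩
  refine ⟨fun j => N (h j), fun j => Φ (h j), fun j => Sum.elim k k' (h j),
    fun q => E (h q.1) q.2, ⟨fun j => hmem (h j), fun j => (hdiv (h j)).mono ?_⟩, ?_⟩
  · rintro _ (hx | ⟨⟨i, r⟩, hij, rfl⟩)
    · rcases h j with p | p
      · exact Or.inl (Or.inl hx)
      · exact Or.inl (Or.inl hx)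
    · exact hbase _ _ r (fun p q => hl i j p q hij) (fun p q => hr i j p q hij)
  · rintro _ ⟨⟨i, r⟩, rfl⟩
    exact hErange _ _

end Sum

end DividingDepth

/-! ### The sum inequality -/

theorem mainTheorem6 {L : FirstOrder.Language.{u, v}} (T : L.Theory)
    (hT : T.IsComplete) (hsimple : DividingDepth.IsSimple.{u, v, w} T)
    (M : Type w) [L.Structure M] (κ : Cardinal.{w}) (hM : DividingDepth.IsMonster T M κ)
    (A : Set M) (hA : Cardinal.mk A < κ)
    (ι ι' : Type w) (hι : Cardinal.mk ι < κ) (hι' : Cardinal.mk ι' < κ)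
    (a : ι → M) (b : ι' → M) (hab : DividingDepth.Indep L A a b)
    (α β : Ordinal.{t})
    (hα : DividingDepth.PlusLeDD α (DividingDepth.tp L A a))
    (hβ : DividingDepth.PlusLeDD β (DividingDepth.tp L (A ∪ Set.range a) b)) :
    DividingDepth.PlusLeDD (DividingDepth.natSum α β)
      (DividingDepth.tp L A (Sum.elim a b)) := by
  have hκ := hM.aleph0_lt
  have hA := DividingDepth.isSmall_of_mk_lt hA
  have hι := DividingDepth.isSmall_of_mk_lt hι
  have hι' := DividingDepth.isSmall_of_mk_lt hι'
  have hJ := hα.isSmall hM hsimple hι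
  have hJ' := hβ.isSmall hM hsimple hι'
  obtain ⟨n, φ, k, e, he⟩ := hα.exists_divChain hM hι hA subset_rfl hJ
  -- The tree over `Aa` is used only through a chain over `A`; independence later restores the
  -- dividing over `a` and its chain.
  obtain ⟨n', ψ, k', e', he'⟩ := hβ.exists_divChain hM hι' hA Set.subset_union_left hJ'
  have hD := hι.sum hκ.le (hJ.sigma_fin hκ n)
  have hD' := hι'.sum hκ.le (hJ'.sigma_fin hκ n')
  -- First `a` becomes independent from `be'`, then, after symmetry, `be'` from `ae`; a last use of
  -- symmetry gives both directions.
  obtain ⟨e', he', hnd⟩ := he'.exists_nonDividing hM hA hι' hι hJ' (DividingDepth.nonForking_of_indep hab)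
  have hsymm := (hnd.nonForking hM hsimple hA).symm hM hsimple hA hι hD'
  obtain ⟨e, he, hnd⟩ :=
    he.exists_nonDividing hM hA hι hD' hJ (hsymm.nonForking hM hsimple hA)
  have hnd' := (hnd.nonForking hM hsimple hA).symm hM hsimple hA hD' hD
  obtain ⟨f, hf⟩ := DividingDepth.exists_isShuffle α β
  obtain ⟨N, Φ, K, E, hE, hrange⟩ := DividingDepth.DivChain.shuffle hf he he'
    (fun j => (he.sDiv_union_range hM hA hι hD' hJ hnd j).mono
      (Set.union_subset_union_right _ (by rintro _ ⟨q, rfl⟩; exact ⟨Sum.inr q, rfl⟩)))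
    (fun j => (he'.sDiv_union_range hM hA hι' hD hJ' hnd' j).mono
      (Set.union_subset_union_right _ (by rintro _ ⟨q, rfl⟩; exact ⟨Sum.inr q, rfl⟩)))
  exact hE.plusLeDD hM hA (((hJ.sigma_fin hκ n).range e).union hκ.le
    ((hJ'.sigma_fin hκ n').range e') |>.subset hrange)
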